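/- Let $m\ge 1$ be an integer, $\varepsilon\in\{1,-1\}$, $\omega=e^{2\pi i\varepsilon/m}$, and for $\underline a=(a_1,\dots,a_m)\in\mathbb C^m$ consider on the universal covering of $\mathbb C^*$ (with coordinate $t=\ln x$, $\arg x=\operatorname{Im}t$, $x^\alpha=e^{\alpha t}$) the equation $$(\mathfrak E_m)\qquad \Phi''(x)=\frac{P_m(x,\underline a)}{x^2}\,\Phi(x),\qquad P_m(x,\underline a)=x^m+a_1x^{m-1}+\dots+a_m .$$ Put $\tau\cdot\underline a=(\tau a_1,\dots,\tau^m a_m)$; on the covering, $\omega^kx$ denotes the point $t+2\pi i\varepsilon k/m$. *Solutions at infinity.* Let $\sqrt{P_m(x,\underline a)}/x\sim x^{m/2-1}+\sum_{k\ge1}b_{m/2-k}(\underline a)x^{m/2-k-1}$ as $x\to\infty$, and set $b_{m/2}=1$, $S(x,\underline a)=\sum_{0\le k<m/2}\frac{b_{m/2-k}(\underline a)}{m/2-k}x^{m/2-k}$, $r(\underline a)=\frac12-\frac m4$ for $m$ odd and $r(\underline a)=\frac12-\frac m4-b_0(\underline a)$ for $m$ even. Let $\Phi_0(x,\underline a)$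 be the solution of $(\mathfrak E_m)$ which, in every strict sub-sector of $\{|\arg x|<3\pi/m\}$, has an asymptotic expansion at infinity $x^{r(\underline a)}e^{-S(x,\underline a)}\phi_0(x,\underline a)$, uniformly for $\underline a$ in compact sets, where $\phi_0$ is a formal power series in $x^{-1}$ ($m$ even) or $x^{-1/2}$ ($m$ odd) with coefficients in $\mathbb C[\underline a]$ and constant term $1$. For $k\in\mathbb Z$ let $\Phi_k(x,\underline a)=\Phi_0(\omega^kx,\omega^k\cdot\underline a)$. *Solutions at the origin.* Fix $\underline a$ and a number $p$ with $p^2=1+4a_m$ that is not a negative integer; let $\underline a'=(a_1,\dots,a_{m-1})$ and $s(p)=\frac{1+p}2$. Let $$f_1=x^{s(p)}g_1(x),\qquad f_2=\lambda f_1\ln x+x^{s(-p)}g_2(x)$$ be the linearly independent solutions of $(\mathfrak E_m)$ with $\lambda=\lambda(\underline a',p)\in\mathbb C$ and $g_1,g_2$ entire functions of $x$, $g_1(0)=1$, normalized as follows: if $p\notin\mathbb Z$, then $\lambda=0$ and $g_2$ is the function $g_1$ for $-p$ in place of $p$; if $p$ is a positive integer, then $g_2(0)=1$ and the coefficient of $x^p$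 in $g_2$ is $0$; if $p=0$, then $\lambda=1$ and $g_2(0)=0$. **Theorem.** The triple $(g_1,g_2,\lambda)$ exists and is unique. For every $k\in\mathbb Z$ there are unique numbers $C_k(\underline a),\tilde C_k(\underline a)$ with $\Phi_{k-1}=C_k\Phi_k+\tilde C_k\Phi_{k+1}$ on the covering; put $\mathfrak S_k(\underline a)=\begin{pmatrix}C_k(\underline a)&\tilde C_k(\underline a)\\1&0\end{pmatrix}$. There is a unique matrix $M_0(\underline a',p)$ with $\begin{pmatrix}\Phi_{-1}\\\Phi_0\end{pmatrix}=M_0(\underline a',p)\begin{pmatrix}f_1\\f_2\end{pmatrix}$, and it is invertible. The matrix $$\mathfrak M(\underline a',p)=\begin{pmatrix}e^{2\pi i\varepsilon s(p)}&0\\2\pi i\varepsilon\,\lambda(\underline a',p)\,e^{2\pi i\varepsilon s(-p)}&e^{2\pi i\varepsilon s(-p)}\end{pmatrix}$$ is invertible and satisfies $\begin{pmatrix}f_1\\f_2\end{pmatrix}(\omega^mx)=\mathfrak M(\underline a',p)\begin{pmatrix}f_1\\f_2\end{pmatrix}(x)$. Moreover $$\mathfrak S_0(\underline a)\,\mathfrak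 S_1(\underline a)\cdots\mathfrak S_{m-1}(\underline a)=M_0(\underline a',p)\,\mathfrak M^{-1}(\underline a',p)\,M_0^{-1}(\underline a',p).$$ -/

import Mathlib

open scoped Matrix

namespace StokesSibuya

noncomputable section

/-! The parameter `a = (a_1, …, a_m)` is a vector `a : Fin m → ℂ`, the entry with index `i`
being `a_{i+1}`. The universal covering of `ℂ \ {0}` is `ℂ` with the projection `t ↦ x = exp t`:
a function on the covering is a function of `t`, the argument of `x` is `t.im`, the logarithm
`ln x` is `t`, and `x ^ α` is `exp (α * t)`. -/

/-- `a_k`, with the conventions `a_0 = 1` and `a_k = 0` for `k > m`. -/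
def coeffA {m : ℕ} (a : Fin m → ℂ) (k : ℕ) : ℂ :=
  if k = 0 then 1 else if h : k - 1 < m then a ⟨k - 1, h⟩ else 0

/-- `P_m(x, a) = x ^ m + a_1 x ^ (m - 1) + ⋯ + a_m`. -/
def P {m : ℕ} (a : Fin m → ℂ) (x : ℂ) : ℂ :=
  ∑ k ∈ Finset.range (m + 1), coeffA a k * x ^ (m - k)

/-- The derivative `d/dx`, for functions on the covering. -/
def xDeriv (F : ℂ → ℂ) (t : ℂ) : ℂ := Complex.exp (-t) * deriv F t

/-- `F` is a solution, on the whole covering, of `d²F/dx² = (P_m(x, a) / x²) F`. -/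
def IsSolution {m : ℕ} (a : Fin m → ℂ) (F : ℂ → ℂ) : Prop :=
  Differentiable ℂ F ∧
    ∀ t, xDeriv (xDeriv F) t = P a (Complex.exp t) / Complex.exp t ^ 2 * F t

/-- The Taylor coefficients of `(1 + a_1 u + ⋯ + a_m u ^ m) ^ (1/2)` at `u = 0`, with the branch
that is `1` at `u = 0`. Hence `P_m(x, a) ^ (1/2) / x` has the expansion
`∑ k, sqrtCoeff a k * x ^ (m/2 - k - 1)` at infinity: `sqrtCoeff a k` is the coefficient
`b_{m/2 - k}(a)`. -/
def sqrtCoeff {m : ℕ} (a : Fin m → ℂ) : ℕ → ℂ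
  | 0 => 1
  | n + 1 => (coeffA a (n + 1) -
      ∑ j : Fin n, sqrtCoeff a (j.val + 1) * sqrtCoeff a (n - j.val)) / 2
termination_by n => n
decreasing_by all_goals omega

/-- The square of the series with coefficients `sqrtCoeff a` is `1 + a_1 u + ⋯ + a_m u ^ m`. -/
theorem sqrtCoeff_sq {m : ℕ} (a : Fin m → ℂ) (n : ℕ) :
    ∑ ij ∈ Finset.HasAntidiagonal.antidiagonal n, sqrtCoeff a ij.1 * sqrtCoeff a ij.2 = coeffA a n := by
  rcases n with _ | n
  · simp [sqrtCoeff, coeffA]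
  · rw [Finset.Nat.sum_antidiagonal_eq_sum_range_succ
      (fun i j => sqrtCoeff a i * sqrtCoeff a j), Finset.sum_range_succ', Finset.sum_range_succ]
    have h : ∑ k ∈ Finset.range n, sqrtCoeff a (k + 1) * sqrtCoeff a (n + 1 - (k + 1))
        = ∑ j : Fin n, sqrtCoeff a (j.val + 1) * sqrtCoeff a (n - j.val) := by
      rw [Finset.sum_range]
      refine Finset.sum_congr rfl fun j _ => ?_
      congr 2
      omega
    have h0 : sqrtCoeff a 0 = 1 := by rw [sqrtCoeff]
    have h1 : sqrtCoeff a (n + 1) = (coeffA a (n + 1) -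
      ∑ j : Fin n, sqrtCoeff a (j.val + 1) * sqrtCoeff a (n - j.val)) / 2 := by
      rw [sqrtCoeff]
    rw [h]
    simp only [Nat.sub_self, Nat.sub_zero, h0, h1]
    ring

/-- `S(x, a) = ∑_{0 ≤ k < m/2} b_{m/2 - k}(a) / (m/2 - k) * x ^ (m/2 - k)`, whose leading term is
`(2/m) x ^ (m/2)`. -/
def S {m : ℕ} (a : Fin m → ℂ) (t : ℂ) : ℂ :=
  ∑ k ∈ Finset.range ((m + 1) / 2),
    sqrtCoeff a k / ((m : ℂ) / 2 - k) * Complex.exp (((m : ℂ) / 2 - k) * t)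

/-- `r(a)`: it is `1/2 - m/4` for odd `m`, and `1/2 - m/4 - b_0(a)` for even `m`. -/
def r {m : ℕ} (a : Fin m → ℂ) : ℂ :=
  1 / 2 - (m : ℂ) / 4 - if Even m then sqrtCoeff a (m / 2) else 0

/-- The expansion at infinity is in powers of `x ^ (-1)` for even `m`, and of `x ^ (-1/2)` for
odd `m`. -/
def gap (m : ℕ) : ℝ := if Even m then 1 else 1 / 2

/-- `Φ₀` (first argument the parameter `a`, second argument the point `t` of the covering) is the
solution with the asymptotic expansion `x ^ r(a) * exp (-S(x, a)) * φ₀(x, a)` at infinity, in every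
strict sub-sector of `|arg x| < 3π/m`, uniformly for `a` in compact sets. Here `φ₀` is a formal
power series in `x ^ (-1)` (`m` even) or `x ^ (-1/2)` (`m` odd), with coefficients `c n`
polynomial in `a` and constant term `1`. -/
def IsCanonicalSolution (m : ℕ) (Φ₀ : (Fin m → ℂ) → ℂ → ℂ) : Prop :=
  (∀ a, IsSolution a (Φ₀ a)) ∧
  ∃ c : ℕ → MvPolynomial (Fin m) ℂ, c 0 = 1 ∧
    ∀ K : Set (Fin m → ℂ), IsCompact K → ∀ θ : ℝ, θ < 3 * Real.pi / m → ∀ N : ℕ,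
      ∃ B R : ℝ, ∀ a ∈ K, ∀ t : ℂ, |t.im| ≤ θ → R ≤ t.re →
        ‖Φ₀ a t * Complex.exp (-(r a * t)) * Complex.exp (S a t) -
            ∑ n ∈ Finset.range N,
              MvPolynomial.eval a (c n) * Complex.exp (-(n * (gap m : ℂ) * t))‖
          ≤ B * Real.exp (-(N * gap m * t.re))

/-- `τ · a = (τ a_1, …, τ ^ m a_m)`. -/
def scale {m : ℕ} (τ : ℂ) (a : Fin m → ℂ) : Fin m → ℂ := fun i => τ ^ (i.val + 1) * a i

/-- `log ω = 2πi ε / m`; multiplication of `x` by `ω ^ k` on the covering is `t ↦ t + k log ω`. -/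
def logOmega (m : ℕ) (ε : ℤ) : ℂ := 2 * Real.pi * Complex.I * ε / m

/-- `Φ_k(x, a) = Φ₀(ω ^ k x, ω ^ k · a)`, where `ω = exp (2πi ε / m)`. -/
def Phi {m : ℕ} (ε : ℤ) (Φ₀ : (Fin m → ℂ) → ℂ → ℂ) (k : ℤ) (a : Fin m → ℂ) (t : ℂ) : ℂ :=
  Φ₀ (scale (Complex.exp (logOmega m ε) ^ k) a) (t + k * logOmega m ε)

/-- The defining relation `Φ_{k-1} = C_k Φ_k + C̃_k Φ_{k+1}` of the Stokes–Sibuya coefficients,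
for the pair `c = (C_k, C̃_k)`. -/
def IsStokesSibuyaCoeff {m : ℕ} (ε : ℤ) (Φ₀ : (Fin m → ℂ) → ℂ → ℂ) (k : ℤ) (a : Fin m → ℂ)
    (c : ℂ × ℂ) : Prop :=
  ∀ t, Phi ε Φ₀ (k - 1) a t = c.1 * Phi ε Φ₀ k a t + c.2 * Phi ε Φ₀ (k + 1) a t

/-- The Stokes–Sibuya connection matrix with coefficients `c = (C_k, C̃_k)`. -/
def stokesSibuyaMatrix (c : ℂ × ℂ) : Matrix (Fin 2) (Fin 2) ℂ := !![c.1, c.2; 1, 0]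

/-- `s(p) = (1 + p) / 2`. -/
def s (p : ℂ) : ℂ := (1 + p) / 2

/-- `g` is entire, `g(0) = 1`, and `x ^ s(q) * g(x)` is a solution. -/
def IsFrobeniusSeries {m : ℕ} (a : Fin m → ℂ) (q : ℂ) (g : ℂ → ℂ) : Prop :=
  Differentiable ℂ g ∧ g 0 = 1 ∧
    IsSolution a (fun t => Complex.exp (s q * t) * g (Complex.exp t))

/-- Candidates for the functions `g₁`, `g₂` and the number `λ` in the system of solutions at the
origin. -/
structure OriginData where
  g₁ : ℂ → ℂ
  g₂ : ℂ → ℂ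
  lam : ℂ

/-- `f₁ = x ^ s(p) g₁(x)`. -/
def OriginData.f₁ (D : OriginData) (p t : ℂ) : ℂ := Complex.exp (s p * t) * D.g₁ (Complex.exp t)

/-- `f₂ = λ f₁ ln(x) + x ^ s(-p) g₂(x)`. -/
def OriginData.f₂ (D : OriginData) (p t : ℂ) : ℂ :=
  D.lam * D.f₁ p t * t + Complex.exp (s (-p) * t) * D.g₂ (Complex.exp t)

/-- `(f₁, f₂)` is the normalized fundamental system of solutions at the origin, for `p` that is
not a negative integer. -/
structure OriginData.IsCanonical {m : ℕ} (D : OriginData) (a : Fin m → ℂ) (p : ℂ) : Prop where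
  first : IsFrobeniusSeries a p D.g₁
  entire : Differentiable ℂ D.g₂
  second : IsSolution a (D.f₂ p)
  linearIndependent : LinearIndependent ℂ ![D.f₁ p, D.f₂ p]
  /-- If `p ∉ ℤ`, then `λ = 0`, and `g₂` is the function `g₁` for `-p`. -/
  nonint : (∀ n : ℤ, p ≠ n) → D.lam = 0 ∧ IsFrobeniusSeries a (-p) D.g₂
  /-- If `p = n` is a positive integer, then `g₂(0) = 1`, and the Taylor coefficient of order `n`
  of `g₂` vanishes. -/
  posint : ∀ n : ℕ, 1 ≤ n → p = n → D.g₂ 0 = 1 ∧ iteratedDeriv n D.g₂ 0 = 0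
  /-- If `p = 0`, then `λ = 1` and `g₂(0) = 0`. -/
  zero : p = 0 → D.lam = 1 ∧ D.g₂ 0 = 0

/-- The explicit monodromy matrix at the origin. -/
def OriginData.monodromy (D : OriginData) (ε : ℤ) (p : ℂ) : Matrix (Fin 2) (Fin 2) ℂ :=
  !![Complex.exp (2 * Real.pi * Complex.I * ε * s p), 0;
     2 * Real.pi * Complex.I * ε * D.lam * Complex.exp (2 * Real.pi * Complex.I * ε * s (-p)),
     Complex.exp (2 * Real.pi * Complex.I * ε * s (-p))]

/-- The defining relation `(Φ_{k-1}, Φ_k)ᵀ = M_k (f₁, f₂)ᵀ` of the `0∞` connection matrix. -/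
def IsConnectionMatrix {m : ℕ} (ε : ℤ) (Φ₀ : (Fin m → ℂ) → ℂ → ℂ) (k : ℤ) (a : Fin m → ℂ)
    (p : ℂ) (D : OriginData) (M : Matrix (Fin 2) (Fin 2) ℂ) : Prop :=
  ∀ t, ![Phi ε Φ₀ (k - 1) a t, Phi ε Φ₀ k a t] = M *ᵥ ![D.f₁ p t, D.f₂ p t]

end

end StokesSibuya

open StokesSibuya

namespace StokesSibuya

noncomputable section

/-! ### The equation in the coordinate `t` -/

/-! In the coordinate `t = ln x` the equation is `F'' = F' + P(exp t) F`. By Abel's identity a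
Wronskian is a constant times `exp t`, so any two independent solutions span all solutions
(`IsSolution.exists_eq_add`). Every connection coefficient thus exists and is unique once
independence is known.

At infinity, independence of `Φ_k` and `Φ_{k+1}` is a comparison of growth: on one ray the first
decays, while the second is seen along the ray rotated by `ω`, where the leading term of `S` has
changed sign, and grows (`IsCanonicalSolution.linearIndependent`).

At the origin, the Frobenius method gives existence. A majorant argument makes the series entire
(`Rapid.of_recursion`). Uniqueness and independence come from continuation once around `0`: it
separates `x^s(p)` from `x^s(-p)` for non-integral `p`, and detects the logarithm for integral `p`
(`eq_zero_of_log_relation`).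

The identity itself is a closed loop. The matrices telescope, so their product `Q` takes `(Φ_{m-1},
Φ_m)` to `(Φ_{-1}, Φ_0)`. As `ω^m = 1`, the former pair is the latter continued by `x ↦ ω^m x`
(`Phi_add_natCast`). In the basis `(f₁, f₂)` this reads `Q M₀ 𝔐 = M₀`. -/

theorem isSolution_iff {m : ℕ} {a : Fin m → ℂ} {F : ℂ → ℂ} :
    IsSolution a F ↔ Differentiable ℂ F ∧
      ∀ t, deriv (deriv F) t = deriv F t + P a (Complex.exp t) * F t := by
  refine and_congr_right fun hF => forall_congr' fun t => ?_
  have h1 : HasDerivAt (fun t : ℂ => Complex.exp (-t)) (-Complex.exp (-t)) t := by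
    simpa using (hasDerivAt_neg t).cexp
  have h2 : HasDerivAt (deriv F) (deriv (deriv F) t) t := (hF.deriv t).hasDerivAt
  have h3 : deriv (xDeriv F) t = -Complex.exp (-t) * deriv F t +
      Complex.exp (-t) * deriv (deriv F) t := (h1.mul h2).deriv
  have h0 : Complex.exp t ≠ 0 := Complex.exp_ne_zero t
  rw [xDeriv, h3, Complex.exp_neg]
  field_simp
  rw [neg_add_eq_iff_eq_add]

theorem IsSolution.of_hasDerivAt {m : ℕ} {a : Fin m → ℂ} {F F' : ℂ → ℂ}
    (h : ∀ t, HasDerivAt F (F' t) t)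
    (h' : ∀ t, HasDerivAt F' (F' t + P a (Complex.exp t) * F t) t) : IsSolution a F := by
  have hd : deriv F = F' := funext fun t => (h t).deriv
  refine isSolution_iff.2 ⟨fun t => (h t).differentiableAt, fun t => ?_⟩
  rw [hd, (h' t).deriv]

/-- The Wronskian of two functions on the covering, with respect to `t`. -/
def wronskian (F G : ℂ → ℂ) (t : ℂ) : ℂ := F t * deriv G t - deriv F t * G t

/-- Abel's identity: the coefficient of `F'` in the equation is `1`, so `W' = W`. -/
theorem IsSolution.exists_wronskian_eq {m : ℕ} {a : Fin m → ℂ} {F G : ℂ → ℂ}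
    (hF : IsSolution a F) (hG : IsSolution a G) :
    ∃ C : ℂ, ∀ t, wronskian F G t = C * Complex.exp t := by
  obtain ⟨dF, hF⟩ := isSolution_iff.1 hF
  obtain ⟨dG, hG⟩ := isSolution_iff.1 hG
  have key : ∀ t, HasDerivAt (fun t => Complex.exp (-t) * wronskian F G t) 0 t := fun t => by
    have h1 : HasDerivAt (fun t : ℂ => Complex.exp (-t)) (-Complex.exp (-t)) t := by
      simpa using (hasDerivAt_neg t).cexp
    have h2 := (((dF t).hasDerivAt.mul (dG.deriv t).hasDerivAt).sub
      ((dF.deriv t).hasDerivAt.mul (dG t).hasDerivAt))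
    refine (h1.mul h2).congr_deriv ?_
    rw [hF, hG]
    simp only [Pi.mul_apply, Pi.sub_apply]
    ring
  refine ⟨Complex.exp (-0) * wronskian F G 0, fun t => ?_⟩
  rw [← is_const_of_deriv_eq_zero (fun t => (key t).differentiableAt) (fun t => (key t).deriv) t 0]
  rw [mul_right_comm, ← Complex.exp_add]
  simp

/-- Entire functions with vanishing Wronskian are proportional. -/
theorem exists_eq_mul_of_wronskian_eq_zero {F G : ℂ → ℂ} (dF : Differentiable ℂ F)
    (dG : Differentiable ℂ G) (hW : ∀ t, wronskian F G t = 0) {t₀ : ℂ} (h₀ : F t₀ ≠ 0) :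
    ∃ c : ℂ, ∀ t, G t = c * F t := by
  -- `F` may vanish elsewhere, so `G / F` is shown constant only on a ball around `t₀`; the identity
  -- theorem extends the relation to the plane.
  obtain ⟨ε, hε, hball⟩ := Metric.eventually_nhds_iff_ball.1
    ((dF.continuous.continuousAt (x := t₀)).eventually_ne h₀)
  have hd : ∀ t ∈ Metric.ball t₀ ε, HasDerivAt (fun t => G t / F t) 0 t := fun t ht => by
    refine ((dG t).hasDerivAt.div (dF t).hasDerivAt (hball t ht)).congr_deriv ?_
    have := hW t
    rw [wronskian] at this
    rw [show deriv G t * F t - G t * deriv F t = 0 by linear_combination this, zero_div]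
  refine ⟨G t₀ / F t₀, fun t => ?_⟩
  have hloc : G =ᶠ[nhds t₀] fun t => G t₀ / F t₀ * F t := by
    filter_upwards [Metric.ball_mem_nhds t₀ hε] with t ht
    have := Metric.isOpen_ball.is_const_of_deriv_eq_zero (convex_ball t₀ ε).isPreconnected
      (fun t ht => (hd t ht).differentiableAt.differentiableWithinAt)
      (fun t ht => (hd t ht).deriv) ht (Metric.mem_ball_self hε)
    rw [← this, div_mul_cancel₀ _ (hball t ht)]
  exact congrFun (AnalyticOnNhd.eq_of_eventuallyEq
    (fun z _ => dG.analyticAt z) (fun z _ => (dF.const_mul _).analyticAt z) hloc) t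

/-- Two linearly independent solutions span the space of solutions. -/
theorem IsSolution.exists_eq_add {m : ℕ} {a : Fin m → ℂ} {F G H : ℂ → ℂ}
    (hF : IsSolution a F) (hG : IsSolution a G) (hH : IsSolution a H)
    (hFG : LinearIndependent ℂ ![F, G]) :
    ∃ α β : ℂ, ∀ t, H t = α * F t + β * G t := by
  obtain ⟨A, hA⟩ := hG.exists_wronskian_eq hH
  obtain ⟨B, hB⟩ := hH.exists_wronskian_eq hF
  obtain ⟨C, hC⟩ := hF.exists_wronskian_eq hG
  have hC0 : C ≠ 0 := by
    rintro rfl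
    have hF0 : F ≠ 0 := hFG.ne_zero 0
    obtain ⟨t₀, ht₀⟩ := Function.ne_iff.1 hF0
    obtain ⟨c, hc⟩ := exists_eq_mul_of_wronskian_eq_zero hF.1 hG.1 (by simpa using hC) ht₀
    have := (LinearIndependent.pair_iff.1 hFG c (-1) (by ext t; simp [hc])).2
    norm_num at this
  refine ⟨-A / C, -B / C, fun t => ?_⟩
  have hA := hA t
  have hB := hB t
  have hC := hC t
  rw [wronskian] at hA hB hC
  have he := Complex.exp_ne_zero t
  -- The cyclic identity `F W(G,H) + G W(H,F) + H W(F,G) = 0`.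
  have : Complex.exp t * (A * F t + B * G t + C * H t) = 0 := by
    linear_combination -F t * hA - G t * hB - H t * hC
  have := (mul_eq_zero.1 this).resolve_left he
  field_simp
  linear_combination this

theorem eq_and_eq_of_linearIndependent {F G : ℂ → ℂ} (h : LinearIndependent ℂ ![F, G])
    {α β α' β' : ℂ} (heq : ∀ t, α * F t + β * G t = α' * F t + β' * G t) :
    α = α' ∧ β = β' := by
  have := LinearIndependent.pair_iff.1 h (α - α') (β - β') (by
    ext t
    simp only [Pi.add_apply, Pi.smul_apply, smul_eq_mul, Pi.zero_apply]
    linear_combination heq t)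
  exact ⟨sub_eq_zero.1 this.1, sub_eq_zero.1 this.2⟩

/-- Continuous functions that agree on `ℂ \ {0}` agree. -/
theorem eq_of_comp_exp_eq {g h : ℂ → ℂ} (hg : Continuous g) (hh : Continuous h)
    (heq : ∀ t, g (Complex.exp t) = h (Complex.exp t)) : g = h :=
  hg.ext_on (dense_compl_singleton (0 : ℂ)) hh fun x hx => by
    rw [← Complex.exp_log hx]
    exact heq _

/-! ### Entire functions given by their Taylor coefficients -/

/-- `d` is the sequence of Taylor coefficients of an entire function. -/
def Rapid (d : ℕ → ℂ) : Prop := ∀ R : ℝ, 0 ≤ R → Summable fun n => ‖d n‖ * R ^ n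

/-- The sum of the power series with coefficients `d`. -/
def powerSum (d : ℕ → ℂ) (x : ℂ) : ℂ := ∑' n, d n * x ^ n

theorem Rapid.summable_norm {d : ℕ → ℂ} (hd : Rapid d) (x : ℂ) :
    Summable fun n => ‖d n * x ^ n‖ := by
  simpa using hd ‖x‖ (norm_nonneg x)

theorem Rapid.summable {d : ℕ → ℂ} (hd : Rapid d) (x : ℂ) :
    Summable fun n => d n * x ^ n := (hd.summable_norm x).of_norm

/-- A bound at radius `2 (R + 1)` gives domination by a geometric series at radius `R`; the `+ 1`
keeps the larger radius positive when `R = 0`. -/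
theorem rapid_of_bounded {d : ℕ → ℂ}
    (h : ∀ R : ℝ, 0 < R → ∃ B : ℝ, ∀ n, ‖d n‖ * R ^ n ≤ B) : Rapid d := fun R hR => by
  obtain ⟨B, hB⟩ := h (2 * (R + 1)) (by linarith)
  refine Summable.of_nonneg_of_le (fun n => by positivity) (fun n => ?_)
    ((summable_geometric_two).mul_left B)
  have h1 : ‖d n‖ * R ^ n ≤ ‖d n‖ * (R + 1) ^ n := by gcongr; linarith
  have h2 := hB n
  rw [mul_pow] at h2
  rw [one_div, inv_pow, ← div_eq_mul_inv, le_div_iff₀ (by positivity)]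
  nlinarith [pow_pos (two_pos (α := ℝ)) n]

theorem Rapid.bounded {d : ℕ → ℂ} (hd : Rapid d) {R : ℝ} (hR : 0 ≤ R) :
    ∃ B : ℝ, 0 ≤ B ∧ ∀ n, ‖d n‖ * R ^ n ≤ B :=
  ⟨∑' n, ‖d n‖ * R ^ n, tsum_nonneg fun n => by positivity,
    fun n => (hd R hR).le_tsum n fun _ _ => by positivity⟩

theorem Rapid.natCast_mul {d : ℕ → ℂ} (hd : Rapid d) : Rapid fun n => (n : ℂ) * d n :=
  rapid_of_bounded fun R hR => by
    obtain ⟨B, -, hB⟩ := hd.bounded (R := 2 * R) (by positivity)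
    refine ⟨B, fun n => le_trans ?_ (hB n)⟩
    have : (n : ℝ) ≤ 2 ^ n := by exact_mod_cast n.lt_two_pow_self.le
    rw [norm_mul, Complex.norm_natCast, mul_pow]
    calc (n : ℝ) * ‖d n‖ * R ^ n ≤ 2 ^ n * ‖d n‖ * R ^ n := by gcongr
      _ = _ := by ring

theorem Rapid.add {d e : ℕ → ℂ} (hd : Rapid d) (he : Rapid e) : Rapid fun n => d n + e n :=
  fun R hR => Summable.of_nonneg_of_le (fun n => by positivity)
    (fun n => by rw [← add_mul]; gcongr; exact norm_add_le _ _) ((hd R hR).add (he R hR))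

theorem Rapid.const_mul {d : ℕ → ℂ} (hd : Rapid d) (c : ℂ) : Rapid fun n => c * d n :=
  fun R hR => by simpa [mul_assoc] using (hd R hR).mul_left ‖c‖

theorem Rapid.linear_mul {d : ℕ → ℂ} (hd : Rapid d) (s : ℂ) : Rapid fun n => (s + n) * d n := by
  simpa only [add_mul] using (hd.const_mul s).add hd.natCast_mul

theorem Rapid.succ_mul {d : ℕ → ℂ} (hd : Rapid d) :
    Rapid fun n => ((n : ℂ) + 1) * d (n + 1) := rapid_of_bounded fun R hR => by
  obtain ⟨B, -, hB⟩ := hd.natCast_mul.bounded hR.le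
  refine ⟨B / R, fun n => ?_⟩
  rw [le_div_iff₀ hR]
  simpa [pow_succ, mul_assoc] using hB (n + 1)

/-- The coefficients of `x ^ p` times the series with coefficients `c`. -/
def shift (p : ℕ) (c : ℕ → ℂ) (n : ℕ) : ℂ := if p ≤ n then c (n - p) else 0

theorem shift_add (p : ℕ) (c : ℕ → ℂ) (n : ℕ) : shift p c (n + p) = c n := by
  simp [shift]

theorem Rapid.shift {c : ℕ → ℂ} (hc : Rapid c) (p : ℕ) : Rapid (shift p c) :=
  rapid_of_bounded fun R hR => by
    obtain ⟨B, hB0, hB⟩ := hc.bounded hR.le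
    refine ⟨B * R ^ p, fun n => ?_⟩
    by_cases h : p ≤ n
    · obtain ⟨k, rfl⟩ := Nat.exists_eq_add_of_le' h
      rw [shift_add, pow_add, ← mul_assoc]
      gcongr
      exact hB k
    · simp only [StokesSibuya.shift, h, if_false, norm_zero, zero_mul]
      positivity

theorem powerSum_shift (p : ℕ) (c : ℕ → ℂ) (x : ℂ) :
    powerSum (shift p c) x = x ^ p * powerSum c x := by
  rw [powerSum, powerSum, ← tsum_mul_left,
    ← (add_left_injective p).tsum_eq (f := fun n => shift p c n * x ^ n)]
  · refine tsum_congr fun n => ?_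
    simp only [shift_add]
    ring
  · intro n hn
    by_contra h
    refine hn ?_
    have : ¬ p ≤ n := fun h' => h ⟨n - p, Nat.sub_add_cancel h'⟩
    simp [shift, this]

theorem powerSum_zero_right (d : ℕ → ℂ) : powerSum d 0 = d 0 := by
  rw [powerSum, tsum_eq_single 0 fun n hn => by simp [hn]]
  simp

theorem Rapid.powerSum_add {d e : ℕ → ℂ} (hd : Rapid d) (he : Rapid e) (x : ℂ) :
    powerSum (fun n => d n + e n) x = powerSum d x + powerSum e x := by
  simp only [powerSum, add_mul]
  exact (hd.summable x).tsum_add (he.summable x)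

theorem powerSum_const_mul (c : ℂ) (d : ℕ → ℂ) (x : ℂ) :
    powerSum (fun n => c * d n) x = c * powerSum d x := by
  simp only [powerSum, mul_assoc, tsum_mul_left]

theorem Rapid.powerSum_mul {A d : ℕ → ℂ} (hA : Rapid A) (hd : Rapid d) (x : ℂ) :
    powerSum A x * powerSum d x =
      powerSum (fun n => ∑ j ∈ Finset.range (n + 1), A (n - j) * d j) x := by
  rw [mul_comm, powerSum, powerSum, powerSum,
    tsum_mul_tsum_eq_tsum_sum_range_of_summable_norm (hd.summable_norm x) (hA.summable_norm x)]
  refine tsum_congr fun n => ?_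
  rw [Finset.sum_mul]
  refine Finset.sum_congr rfl fun j hj => ?_
  have : x ^ n = x ^ j * x ^ (n - j) := by
    rw [← pow_add, Nat.add_sub_cancel' (Finset.mem_range_succ_iff.1 hj)]
  rw [this]
  ring

theorem Rapid.hasDerivAt_powerSum {d : ℕ → ℂ} (hd : Rapid d) (x : ℂ) :
    HasDerivAt (powerSum d) (powerSum (fun n => ((n : ℂ) + 1) * d (n + 1)) x) x := by
  have hx : x ∈ Metric.ball (0 : ℂ) (‖x‖ + 1) := by simp
  have hf : ∀ n : ℕ, DifferentiableOn ℂ (fun x : ℂ => d n * x ^ n) (Metric.ball 0 (‖x‖ + 1)) :=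
    fun n => by fun_prop
  have hu := hd (‖x‖ + 1) (by positivity)
  have hle : ∀ (n : ℕ) (w : ℂ), w ∈ Metric.ball (0 : ℂ) (‖x‖ + 1) →
      ‖d n * w ^ n‖ ≤ ‖d n‖ * (‖x‖ + 1) ^ n := fun n w hw => by
    rw [norm_mul, norm_pow]
    gcongr
    exact (mem_ball_zero_iff.1 hw).le
  have h1 := (Complex.differentiableOn_tsum_of_summable_norm hu hf Metric.isOpen_ball
    hle).differentiableAt (Metric.isOpen_ball.mem_nhds hx)
  have h2 := (Complex.hasSum_deriv_of_summable_norm hu hf Metric.isOpen_ball hle hx)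
  refine h1.hasDerivAt.congr_deriv ?_
  rw [← h2.tsum_eq, h2.summable.tsum_eq_zero_add, powerSum]
  simp only [pow_zero, deriv_const, zero_add]
  refine tsum_congr fun n => ?_
  rw [deriv_const_mul _ (differentiableAt_pow _), mul_right_comm, mul_comm]
  simp

theorem Rapid.differentiable {d : ℕ → ℂ} (hd : Rapid d) : Differentiable ℂ (powerSum d) :=
  fun x => (hd.hasDerivAt_powerSum x).differentiableAt

theorem Rapid.iteratedDeriv_zero {d : ℕ → ℂ} (hd : Rapid d) (n : ℕ) :
    iteratedDeriv n (powerSum d) 0 = n.factorial * d n := by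
  induction n generalizing d with
  | zero => simp [powerSum_zero_right]
  | succ n ih =>
    rw [iteratedDeriv_succ', show deriv (powerSum d) = _ from
      funext fun x => (hd.hasDerivAt_powerSum x).deriv]
    refine (ih hd.succ_mul).trans ?_
    push_cast [Nat.factorial_succ]
    ring

theorem Rapid.mul_powerSum_succ {d : ℕ → ℂ} (hd : Rapid d) (x : ℂ) :
    x * powerSum (fun n => ((n : ℂ) + 1) * d (n + 1)) x = powerSum (fun n => (n : ℂ) * d n) x := by
  rw [powerSum, powerSum, ← tsum_mul_left, (hd.natCast_mul.summable x).tsum_eq_zero_add]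
  simp only [Nat.cast_zero, zero_mul, zero_add, Nat.cast_add, Nat.cast_one]
  exact tsum_congr fun n => by ring

/-- The derivative of `x ^ s * ∑ d_n x ^ n` with respect to `t = ln x`. -/
theorem Rapid.hasDerivAt_exp_mul {d : ℕ → ℂ} (hd : Rapid d) (s t : ℂ) :
    HasDerivAt (fun t => Complex.exp (s * t) * powerSum d (Complex.exp t))
      (Complex.exp (s * t) * powerSum (fun n => (s + n) * d n) (Complex.exp t)) t := by
  have h1 : HasDerivAt (fun t => Complex.exp (s * t)) (Complex.exp (s * t) * (s * 1)) t :=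
    ((hasDerivAt_id t).const_mul s).cexp
  have h2 := (hd.hasDerivAt_powerSum (Complex.exp t)).comp t (Complex.hasDerivAt_exp t)
  refine (h1.mul h2).congr_deriv ?_
  simp only [Function.comp]
  rw [show (fun n : ℕ => (s + n) * d n) = fun n => s * d n + n * d n from
    funext fun n => add_mul _ _ _, (hd.const_mul s).powerSum_add hd.natCast_mul, powerSum_const_mul,
    ← hd.mul_powerSum_succ]
  ring

/-! ### Solutions at the origin -/

/-- Majorant argument at a fixed radius: a bound `B` for the earlier terms bounds the right-hand
side by `(K + H) B`, and the factor `n (n + q)` eventually exceeds `K + H`. The initial terms,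
including any resonant index, are absorbed into `B`, and `1 ≤ B` absorbs `H`. -/
theorem Rapid.of_recursion {A h d : ℕ → ℂ} {q : ℂ} (hA : Rapid A) (hh : Rapid h)
    (hrec : ∀ n : ℕ, (n : ℂ) * (n + q) ≠ 0 →
      (n : ℂ) * (n + q) * d n = ∑ j ∈ Finset.range n, A (n - j) * d j + h n) : Rapid d := by
  refine rapid_of_bounded fun R hR => ?_
  obtain ⟨H, hH0, hH⟩ := hh.bounded hR.le
  set K := ∑' n, ‖A n‖ * R ^ n with hK
  have hK0 : 0 ≤ K := tsum_nonneg fun n => by positivity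
  obtain ⟨N, hN⟩ := exists_nat_ge (‖q‖ + 1 + (K + H))
  set B := 1 + ∑ n ∈ Finset.range N, ‖d n‖ * R ^ n with hB
  have hB1 : 1 ≤ B := le_add_of_nonneg_right (Finset.sum_nonneg fun n _ => by positivity)
  refine ⟨B, fun n => ?_⟩
  induction n using Nat.strong_induction_on with
  | _ n ih =>
    by_cases hn : n < N
    · have := Finset.single_le_sum (f := fun n => ‖d n‖ * R ^ n) (fun n _ => by positivity)
        (Finset.mem_range.2 hn)
      linarith
    · have hn' : (N : ℝ) ≤ n := by exact_mod_cast not_lt.1 hn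
      have h1 : 1 + (K + H) ≤ ‖(n : ℂ) + q‖ := by
        have := norm_sub_le ((n : ℂ) + q) q
        rw [add_sub_cancel_right, Complex.norm_natCast] at this
        linarith
      have h2 : 1 + (K + H) ≤ ‖(n : ℂ) * (n + q)‖ := by
        rw [norm_mul, Complex.norm_natCast]
        have : (1 : ℝ) ≤ n := by linarith [norm_nonneg q]
        nlinarith [norm_nonneg ((n : ℂ) + q)]
      have hne : (n : ℂ) * (n + q) ≠ 0 := norm_pos_iff.1 (by linarith)
      have h3 : ‖(n : ℂ) * (n + q)‖ * (‖d n‖ * R ^ n) ≤ (K + H) * B := by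
        rw [← mul_assoc, ← norm_mul, hrec n hne]
        calc ‖∑ j ∈ Finset.range n, A (n - j) * d j + h n‖ * R ^ n
            ≤ (∑ j ∈ Finset.range n, ‖A (n - j)‖ * ‖d j‖ + ‖h n‖) * R ^ n := by
              gcongr
              refine (norm_add_le _ _).trans ?_
              gcongr
              exact (norm_sum_le _ _).trans_eq (by simp only [norm_mul])
          _ = ∑ j ∈ Finset.range n, (‖A (n - j)‖ * R ^ (n - j)) * (‖d j‖ * R ^ j)
              + ‖h n‖ * R ^ n := by
              rw [add_mul, Finset.sum_mul]
              congr 1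
              refine Finset.sum_congr rfl fun j hj => ?_
              rw [← Nat.sub_add_cancel (Finset.mem_range.1 hj).le, pow_add]
              simp only [Nat.sub_add_cancel (Finset.mem_range.1 hj).le]
              ring
          _ ≤ ∑ j ∈ Finset.range n, (‖A (n - j)‖ * R ^ (n - j)) * B + H := by
              refine add_le_add (Finset.sum_le_sum fun j hj => ?_) (hH n)
              gcongr
              exact ih j (Finset.mem_range.1 hj)
          _ ≤ ∑ j ∈ Finset.range (n + 1), (‖A (n - j)‖ * R ^ (n - j)) * B + H := by
              rw [Finset.sum_range_succ]
              have : 0 ≤ ‖A (n - n)‖ * R ^ (n - n) * B := by positivity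
              linarith
          _ = (∑ j ∈ Finset.range (n + 1), ‖A j‖ * R ^ j) * B + H := by
              rw [← Finset.sum_mul, ← Finset.sum_range_reflect (fun j => ‖A j‖ * R ^ j)]
              simp
          _ ≤ K * B + H := by
              gcongr
              exact (hA R hR.le).sum_le_tsum _ fun _ _ => by positivity
          _ ≤ (K + H) * B := by nlinarith
      have h4 : 0 ≤ ‖d n‖ * R ^ n := by positivity
      by_contra hlt
      push Not at hlt
      nlinarith

open Classical in
/-- The solution of `n (n + q) d_n = ∑_{j < n} A_{n-j} d_j + h_n`, with `d_n` prescribed where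
`n (n + q) = 0`. -/
def frobeniusCoeff (A : ℕ → ℂ) (q : ℂ) (h init : ℕ → ℂ) (n : ℕ) : ℂ :=
  if (n : ℂ) * (n + q) = 0 then init n
  else (∑ j : Fin n, A (n - j.val) * frobeniusCoeff A q h init j.val + h n) / (n * (n + q))
termination_by n
decreasing_by exact j.2

theorem frobeniusCoeff_of_eq_zero {A : ℕ → ℂ} {q : ℂ} {h init : ℕ → ℂ} {n : ℕ}
    (hn : (n : ℂ) * (n + q) = 0) : frobeniusCoeff A q h init n = init n := by
  rw [frobeniusCoeff, if_pos hn]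

theorem frobeniusCoeff_rec {A : ℕ → ℂ} {q : ℂ} {h init : ℕ → ℂ} {n : ℕ}
    (hn : (n : ℂ) * (n + q) ≠ 0) :
    (n : ℂ) * (n + q) * frobeniusCoeff A q h init n =
      ∑ j ∈ Finset.range n, A (n - j) * frobeniusCoeff A q h init j + h n := by
  rw [frobeniusCoeff, if_neg hn, mul_div_cancel₀ _ hn, Finset.sum_range]

/-- This allows `λ` to be fixed before the inhomogeneous term `h`, which depends on `λ` but vanishes
below order `p`. -/
theorem frobeniusCoeff_congr {A : ℕ → ℂ} {q : ℂ} {h h' init : ℕ → ℂ} {N : ℕ}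
    (hh : ∀ n < N, h n = h' n) {n : ℕ} (hn : n < N) :
    frobeniusCoeff A q h init n = frobeniusCoeff A q h' init n := by
  induction n using Nat.strong_induction_on with
  | _ n ih =>
    rw [frobeniusCoeff, frobeniusCoeff, hh n hn]
    simp only [fun j : Fin n => ih j.val j.2 (j.2.trans hn)]

/-- The coefficients of `P_m(x, a)`, in increasing order. -/
def coeffP {m : ℕ} (a : Fin m → ℂ) (k : ℕ) : ℂ := if k ≤ m then coeffA a (m - k) else 0

theorem rapid_coeffP {m : ℕ} (a : Fin m → ℂ) : Rapid (coeffP a) := fun R _ =>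
  summable_of_ne_finset_zero (s := Finset.range (m + 1)) fun k hk => by
    rw [Finset.mem_range_succ_iff] at hk
    simp [coeffP, hk]

theorem powerSum_coeffP {m : ℕ} (a : Fin m → ℂ) (x : ℂ) : powerSum (coeffP a) x = P a x := by
  rw [powerSum, tsum_eq_sum (s := Finset.range (m + 1)) fun k hk => by
    rw [Finset.mem_range_succ_iff] at hk
    simp [coeffP, hk], P, ← Finset.sum_range_reflect]
  refine Finset.sum_congr rfl fun k hk => ?_
  have hk := Finset.mem_range_succ_iff.1 hk
  simp only [Nat.add_sub_cancel, coeffP, Nat.sub_le, if_true, Nat.sub_sub_self hk]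

/-- The recursion for the coefficients, as an equation for the entire function. -/
theorem Rapid.powerSum_eq_of_recursion {A h d : ℕ → ℂ} {q : ℂ} (hA : Rapid A) (hh : Rapid h)
    (hd : Rapid d) (hq : q ^ 2 = 1 + 4 * A 0)
    (hrec : ∀ n : ℕ, (n : ℂ) * (n + q) * d n = ∑ j ∈ Finset.range n, A (n - j) * d j + h n)
    (x : ℂ) :
    powerSum (fun n => (s q + n) * ((s q + n) * d n)) x =
      powerSum (fun n => (s q + n) * d n) x + powerSum A x * powerSum d x + powerSum h x := by
  have h1 := hd.linear_mul (s q)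
  -- Since `s(q)² - s(q) = A₀`, the indicial factor `(s(q) + n)² - (s(q) + n) - A₀` equals `n (n +
  -- q)`.
  have h2 : (fun n => ∑ j ∈ Finset.range (n + 1), A (n - j) * d j) = fun n =>
      (s q + n) * ((s q + n) * d n) + ((-1) * ((s q + n) * d n) + (-1) * h n) := by
    funext n
    rw [Finset.sum_range_succ, Nat.sub_self]
    have := hrec n
    simp only [s]
    linear_combination -this - d n / 4 * hq
  rw [hA.powerSum_mul hd, h2, (h1.linear_mul (s q)).powerSum_add
    ((h1.const_mul (-1)).add (hh.const_mul (-1))),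
    (h1.const_mul (-1)).powerSum_add (hh.const_mul (-1)), powerSum_const_mul, powerSum_const_mul]
  ring

theorem exists_isFrobeniusSeries {m : ℕ} (a : Fin m → ℂ) {q : ℂ}
    (hq : q ^ 2 = 1 + 4 * coeffA a m) (hneg : ∀ n : ℕ, 1 ≤ n → q ≠ -(n : ℂ)) :
    ∃ c : ℕ → ℂ, Rapid c ∧ IsFrobeniusSeries a q (powerSum c) := by
  set c := frobeniusCoeff (coeffP a) q 0 1 with hc
  have h0 : c 0 = 1 := frobeniusCoeff_of_eq_zero (by simp)
  have hzero : Rapid 0 := fun R _ => by simp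
  have hrec : ∀ n : ℕ, (n : ℂ) * (n + q) * c n =
      ∑ j ∈ Finset.range n, coeffP a (n - j) * c j + (0 : ℕ → ℂ) n := fun n => by
    rcases Nat.eq_zero_or_pos n with rfl | hn
    · simp
    · refine frobeniusCoeff_rec (mul_ne_zero (Nat.cast_ne_zero.2 hn.ne') fun h => ?_)
      exact hneg n hn (by linear_combination h)
  have hrap : Rapid c := Rapid.of_recursion (rapid_coeffP a) hzero fun n _ => hrec n
  refine ⟨c, hrap, hrap.differentiable, (powerSum_zero_right c).trans h0,
    IsSolution.of_hasDerivAt (hrap.hasDerivAt_exp_mul (s q)) fun t =>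
      ((hrap.linear_mul (s q)).hasDerivAt_exp_mul (s q) t).congr_deriv ?_⟩
  rw [(rapid_coeffP a).powerSum_eq_of_recursion hzero hrap (by simpa [coeffP] using hq) hrec,
    powerSum_coeffP, show powerSum 0 (Complex.exp t) = 0 by simp [powerSum]]
  ring

theorem exp_s_natCast (n : ℕ) (t : ℂ) :
    Complex.exp (s n * t) = Complex.exp (s (-n) * t) * Complex.exp t ^ n := by
  rw [← Complex.exp_nat_mul, ← Complex.exp_add]
  congr 1
  simp only [s]
  ring

/-- The second solution at the origin when `p` is a natural number. -/
theorem exists_log_solution {m : ℕ} (a : Fin m → ℂ) (p : ℕ) {c : ℕ → ℂ} (hc : Rapid c)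
    (hp : (p : ℂ) ^ 2 = 1 + 4 * coeffA a m) (hF : IsFrobeniusSeries a p (powerSum c)) :
    ∃ (lam : ℂ) (d : ℕ → ℂ), Rapid d ∧ (p = 0 → lam = 1 ∧ d 0 = 0) ∧
      (1 ≤ p → d 0 = 1 ∧ d p = 0) ∧
      IsSolution a (fun t => lam * (Complex.exp (s p * t) * powerSum c (Complex.exp t)) * t +
        Complex.exp (s (-p) * t) * powerSum d (Complex.exp t)) := by
  set A := coeffP a with hA
  have hc0 : c 0 = 1 := by rw [← powerSum_zero_right c]; exact hF.2.1
  -- One choice serves both normalizations: `d₀ = 1`, `d_p = 0` for `p ≥ 1`, and `d₀ = 0` for `p =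
  -- 0`.
  set init : ℕ → ℂ := fun n => if n = p then 0 else 1 with hinit
  -- At `n = p` the left side of the recursion vanishes and `h_p = -λ p`, so solvability dictates
  -- `λ`. For `p = 0` there is no condition and `λ` is normalized to `1`.
  set lam : ℂ := if p = 0 then 1 else
    (∑ j ∈ Finset.range p, A (p - j) * frobeniusCoeff A (-p) 0 init j) / p with hlam
  -- Inserting `λ f₁ t` in the equation leaves `λ (2 f₁' - f₁)`, which `h` cancels; the shift
  -- accounts for `x^s(p) = x^s(-p) x^p`.
  set h : ℕ → ℂ := shift p fun n => -lam * (2 * ((s p + n) * c n) + (-1) * c n) with hh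
  have hrh0 := ((hc.linear_mul (s p)).const_mul 2).add (hc.const_mul (-1))
  have hrh : Rapid h := (hrh0.const_mul (-lam)).shift p
  set d := frobeniusCoeff A (-p) h init with hd
  have hrec : ∀ n : ℕ, (n : ℂ) * (n + -p) * d n =
      ∑ j ∈ Finset.range n, A (n - j) * d j + h n := fun n => by
    by_cases hn : (n : ℂ) * (n + -p) = 0
    · rw [hn, zero_mul]
      have hhp : h p = -lam * p := by
        simp only [hh, shift, le_refl, if_true, Nat.sub_self, hc0, s, Nat.cast_zero]
        ring
      rcases Nat.eq_zero_or_pos p with hp0 | hp0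
      · have hn0 : n = 0 := by
          rw [hp0] at hn
          simpa using hn
        rw [hn0]
        conv_rhs => rw [← hp0, hhp, hp0]
        simp
      · rcases mul_eq_zero.1 hn with hn | hn
        · have : n = 0 := by exact_mod_cast hn
          subst this
          simp [hh, shift, hp0.ne']
        · have : n = p := by exact_mod_cast add_neg_eq_zero.1 hn
          subst this
          rw [hhp, hlam, if_neg hp0.ne', neg_mul, div_mul_cancel₀ _ (Nat.cast_ne_zero.2 hp0.ne'),
            eq_comm, add_neg_eq_zero]
          refine Finset.sum_congr rfl fun j hj => ?_
          rw [hd, frobeniusCoeff_congr (N := n) (h' := 0) (fun k hk => ?_) (Finset.mem_range.1 hj)]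
          simp [hh, shift, hk]
    · exact frobeniusCoeff_rec hn
  have hrd : Rapid d := Rapid.of_recursion (rapid_coeffP a) hrh fun n _ => hrec n
  have hd0 : d 0 = init 0 := frobeniusCoeff_of_eq_zero (by simp)
  refine ⟨lam, d, hrd, fun h0 => ⟨by simp [hlam, h0], by rw [hd0, hinit]; simp [h0]⟩,
    fun h1 => ⟨by rw [hd0, hinit]; simp; omega, ?_⟩, ?_⟩
  · rw [hd, frobeniusCoeff_of_eq_zero (by simp)]
    simp [hinit]
  · have hf := hc.hasDerivAt_exp_mul (s p)
    have hf2 := (hc.linear_mul (s p)).hasDerivAt_exp_mul (s p)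
    have hg := hrd.hasDerivAt_exp_mul (s (-p))
    have hg2 := (hrd.linear_mul (s (-p))).hasDerivAt_exp_mul (s (-p))
    refine IsSolution.of_hasDerivAt
      (fun t => (((hf t).const_mul lam).mul (hasDerivAt_id t)).add (hg t)) fun t => ?_
    have h1 := (((((hf2 t).const_mul lam).mul (hasDerivAt_id t)).add
      (((hf t).const_mul lam).mul_const 1)).add (hg2 t))
    refine h1.congr_deriv ?_
    have hode := (isSolution_iff.1 hF.2.2).2 t
    rw [show deriv (fun t => Complex.exp (s p * t) * powerSum c (Complex.exp t)) = _ from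
      funext fun t => (hf t).deriv, (hf2 t).deriv] at hode
    beta_reduce at hode
    rw [(rapid_coeffP a).powerSum_eq_of_recursion hrh hrd (by simpa [coeffP] using hp) hrec,
      hh, powerSum_shift, powerSum_const_mul,
      ((hc.linear_mul (s p)).const_mul 2).powerSum_add (hc.const_mul (-1)), powerSum_const_mul,
      powerSum_const_mul, powerSum_coeffP]
    simp only [id]
    have := exp_s_natCast p t
    rw [hode, this]
    ring

/-! ### Continuation around the origin: independence, uniqueness, monodromy. -/

theorem exists_exp_mul_ne_zero {g : ℂ → ℂ} (hg : Continuous g) (h0 : g 0 ≠ 0) (σ : ℂ) :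
    ∃ t, Complex.exp (σ * t) * g (Complex.exp t) ≠ 0 := by
  by_contra! h
  refine h0 (congrFun (eq_of_comp_exp_eq hg continuous_const fun t => ?_) 0 : g 0 = 0)
  exact (mul_eq_zero.1 (h t)).resolve_left (Complex.exp_ne_zero _)

theorem exp_add_two_pi (ε : ℤ) (t : ℂ) :
    Complex.exp (t + 2 * Real.pi * Complex.I * ε) = Complex.exp t := by
  rw [Complex.exp_add, show 2 * (Real.pi : ℂ) * Complex.I * ε = ε * (2 * Real.pi * Complex.I) by
    ring, Complex.exp_int_mul_two_pi_mul_I, mul_one]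

theorem exp_mul_add_two_pi (ε : ℤ) (σ t : ℂ) :
    Complex.exp (σ * (t + 2 * Real.pi * Complex.I * ε)) =
      Complex.exp (2 * Real.pi * Complex.I * ε * σ) * Complex.exp (σ * t) := by
  rw [← Complex.exp_add]
  congr 1
  ring

/-- The exponents `s(n)` and `s(-n)` differ by the integer `n`. -/
theorem exp_two_pi_s_natCast (ε : ℤ) (n : ℕ) :
    Complex.exp (2 * Real.pi * Complex.I * ε * s n) =
      Complex.exp (2 * Real.pi * Complex.I * ε * s (-n)) := by
  have := exp_s_natCast n (2 * Real.pi * Complex.I * ε)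
  rw [mul_comm, this, mul_comm (s _)]
  have h := exp_add_two_pi ε 0
  rw [zero_add, Complex.exp_zero] at h
  rw [h, one_pow, mul_one]

theorem exp_two_pi_s_eq_iff (p q : ℂ) :
    Complex.exp (2 * Real.pi * Complex.I * (1 : ℤ) * s p) =
      Complex.exp (2 * Real.pi * Complex.I * (1 : ℤ) * s q) ↔ ∃ n : ℤ, p = q + 2 * n := by
  rw [Complex.exp_eq_exp_iff_exists_int]
  refine exists_congr fun n => ?_
  have h := Complex.two_pi_I_ne_zero
  rw [← sub_eq_zero, ← sub_eq_zero (a := p)]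
  rw [show 2 * (Real.pi : ℂ) * Complex.I * (1 : ℤ) * s p -
      (2 * Real.pi * Complex.I * (1 : ℤ) * s q + n * (2 * Real.pi * Complex.I)) =
      2 * Real.pi * Complex.I * ((p - (q + 2 * n)) / 2) by simp only [s]; push_cast; ring]
  simp [h]

/-- `ln x` does not occur in a relation with coefficients single-valued up to a factor. -/
theorem eq_zero_of_log_relation {n : ℕ} {g k : ℂ → ℂ} (hg : Continuous g) (hg0 : g 0 ≠ 0)
    (hk : Continuous k) {u : ℂ}
    (h : ∀ t, u * (Complex.exp (s n * t) * g (Complex.exp t)) * t +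
      Complex.exp (s (-n) * t) * k (Complex.exp t) = 0) : u = 0 ∧ k = 0 := by
  have hu : u = 0 := by
    obtain ⟨t, ht⟩ := exists_exp_mul_ne_zero hg hg0 (s n)
    -- One turn multiplies both exponentials by the same factor but adds `2πi` to `t`; subtracting
    -- the original relation isolates `u`.
    have h1 := h (t + 2 * Real.pi * Complex.I * (1 : ℤ))
    rw [exp_add_two_pi, exp_mul_add_two_pi, exp_mul_add_two_pi, exp_two_pi_s_natCast] at h1
    have h2 := Complex.exp_ne_zero (2 * Real.pi * Complex.I * (1 : ℤ) * s (-n))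
    have h3 : Complex.exp (2 * Real.pi * Complex.I * (1 : ℤ) * s (-n)) *
        (u * (Complex.exp (s n * t) * g (Complex.exp t)) * (2 * Real.pi * Complex.I)) = 0 := by
      push_cast at h1 ⊢
      linear_combination h1 - Complex.exp (2 * Real.pi * Complex.I * 1 * s (-n)) * h t
    simpa [Complex.two_pi_I_ne_zero, ht, h2, Complex.I_ne_zero, Real.pi_ne_zero,
      mul_ne_zero_iff.1 ht] using h3
  refine ⟨hu, eq_of_comp_exp_eq hk continuous_const fun t => ?_⟩
  have := h t
  rw [hu] at this
  simpa using this

theorem IsFrobeniusSeries.hasDerivAt {m : ℕ} {a : Fin m → ℂ} {q : ℂ} {g : ℂ → ℂ}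
    (hg : IsFrobeniusSeries a q g) (t : ℂ) :
    HasDerivAt (fun t => Complex.exp (s q * t) * g (Complex.exp t))
      (Complex.exp (s q * t) * (s q * g (Complex.exp t) +
        Complex.exp t * deriv g (Complex.exp t))) t := by
  have h1 : HasDerivAt (fun t => Complex.exp (s q * t)) (Complex.exp (s q * t) * (s q * 1)) t :=
    ((hasDerivAt_id t).const_mul _).cexp
  have h2 := (hg.1 (Complex.exp t)).hasDerivAt.comp t (Complex.hasDerivAt_exp t)
  refine (h1.mul h2).congr_deriv ?_
  simp only [Function.comp]
  ring

/-- The Wronskian gives `x^(1+q) (g h' - g' h) = C`. If `q` is a natural number, evaluation at `x =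
0` yields `C = 0`. Otherwise `C ≠ 0` would make `x^(1+q)` single-valued, so `q` would be an integer,
hence a negative one, which is excluded. The series are then proportional, with equal value at `0`.
-/
theorem IsFrobeniusSeries.unique {m : ℕ} {a : Fin m → ℂ} {q : ℂ} {g h : ℂ → ℂ}
    (hneg : ∀ n : ℕ, 1 ≤ n → q ≠ -(n : ℂ))
    (hg : IsFrobeniusSeries a q g) (hh : IsFrobeniusSeries a q h) : g = h := by
  obtain ⟨C, hC⟩ := hg.2.2.exists_wronskian_eq hh.2.2
  have hcg := hg.1.continuous
  have hch := hh.1.continuous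
  have hcg' := (hg.1.contDiff (n := 1)).continuous_deriv le_rfl
  have hch' := (hh.1.contDiff (n := 1)).continuous_deriv le_rfl
  have hC' : ∀ t, Complex.exp ((1 + q) * t) * (g (Complex.exp t) * deriv h (Complex.exp t) -
      deriv g (Complex.exp t) * h (Complex.exp t)) = C := fun t => by
    have := hC t
    rw [wronskian, (hg.hasDerivAt t).deriv, (hh.hasDerivAt t).deriv] at this
    refine mul_right_cancel₀ (Complex.exp_ne_zero t) ?_
    rw [← this, show (1 + q) * t = s q * t + s q * t by simp only [s]; ring, Complex.exp_add]
    ring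
  have hC0 : C = 0 := by
    by_cases hq : ∃ n : ℕ, q = n
    · obtain ⟨n, rfl⟩ := hq
      have := congrFun (eq_of_comp_exp_eq
        (g := fun x => x ^ (n + 1) * (g x * deriv h x - deriv g x * h x)) (h := fun _ => C)
        (by fun_prop) continuous_const fun t => by
          rw [← hC' t, ← Complex.exp_nat_mul]
          push_cast
          rw [add_comm (n : ℂ)]) 0
      simpa using this.symm
    · by_contra hC0
      have h1 := hC' (0 + 2 * Real.pi * Complex.I * (1 : ℤ))
      rw [exp_mul_add_two_pi, exp_add_two_pi, mul_assoc, hC' 0, mul_eq_right₀ hC0,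
        Complex.exp_eq_one_iff] at h1
      obtain ⟨k, hk⟩ := h1
      have hk' : 1 + q = k := by
        refine mul_left_cancel₀ Complex.two_pi_I_ne_zero ?_
        push_cast at hk
        linear_combination hk
      rcases le_or_gt 1 k with hk1 | hk1
      · obtain ⟨n, hn⟩ := Int.eq_ofNat_of_zero_le (sub_nonneg.2 hk1)
        refine hq ⟨n, ?_⟩
        have : ((k - 1 : ℤ) : ℂ) = n := by rw [hn, Int.cast_natCast]
        push_cast at this
        linear_combination hk' + this
      · obtain ⟨n, hn⟩ := Int.eq_ofNat_of_zero_le (show 0 ≤ 0 - k by omega)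
        refine hneg (n + 1) (by omega) ?_
        have : ((0 - k : ℤ) : ℂ) = n := by rw [hn, Int.cast_natCast]
        push_cast at this ⊢
        linear_combination hk' - this
  obtain ⟨t₀, h₀⟩ := exists_exp_mul_ne_zero hcg (by rw [hg.2.1]; exact one_ne_zero) (s q)
  obtain ⟨c, hc⟩ := exists_eq_mul_of_wronskian_eq_zero hg.2.2.1 hh.2.2.1
    (fun t => by rw [hC t, hC0, zero_mul]) h₀
  have heq : h = fun x => c * g x := eq_of_comp_exp_eq hch (by fun_prop) fun t =>
    mul_left_cancel₀ (Complex.exp_ne_zero (s q * t)) (by linear_combination hc t)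
  have hc1 : c = 1 := by
    have := congrFun heq 0
    simpa [hg.2.1, hh.2.1] using this.symm
  rw [heq, hc1]
  simp

theorem natCast_or_forall_int_ne {p : ℂ} (hneg : ∀ n : ℕ, 1 ≤ n → p ≠ -(n : ℂ)) :
    (∃ n : ℕ, p = n) ∨ ∀ n : ℤ, p ≠ n := by
  refine or_iff_not_imp_right.2 fun hp => ?_
  push Not at hp
  obtain ⟨k, hk⟩ := hp
  obtain ⟨n, rfl | rfl⟩ := Int.eq_nat_or_neg k
  · exact ⟨n, by simpa using hk⟩
  · rcases Nat.eq_zero_or_pos n with rfl | h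
    · exact ⟨0, by simpa using hk⟩
    · exact absurd (by simpa using hk) (hneg n h)

/-- A criterion for the linear independence of the solutions at the origin. -/
theorem OriginData.linearIndependent_of {D : OriginData} {p : ℂ} (h1 : Continuous D.g₁)
    (h10 : D.g₁ 0 = 1) (h2 : Continuous D.g₂)
    (hn : (∀ n : ℤ, p ≠ n) → D.lam = 0 ∧ D.g₂ 0 = 1)
    (hpos : ∀ n : ℕ, 1 ≤ n → p = n → D.g₂ 0 = 1) (hz : p = 0 → D.lam = 1)
    (hneg : ∀ n : ℕ, 1 ≤ n → p ≠ -(n : ℂ)) : LinearIndependent ℂ ![D.f₁ p, D.f₂ p] := by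
  have h10' : D.g₁ 0 ≠ 0 := by rw [h10]; exact one_ne_zero
  obtain ⟨t₁, ht₁⟩ := exists_exp_mul_ne_zero h1 h10' (s p)
  refine LinearIndependent.pair_iff.2 fun α β hαβ => ?_
  have hαβ : ∀ t, α * D.f₁ p t + β * D.f₂ p t = 0 := fun t => by
    simpa using congrFun hαβ t
  simp only [f₂, f₁] at hαβ
  suffices hβ : β = 0 by
    refine ⟨?_, hβ⟩
    have := hαβ t₁
    rw [hβ, zero_mul, add_zero] at this
    exact (mul_eq_zero.1 this).resolve_right ht₁
  rcases natCast_or_forall_int_ne hneg with ⟨n, rfl⟩ | hp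
  · obtain ⟨hu, hk⟩ := eq_zero_of_log_relation (n := n) h1 h10' (u := β * D.lam)
      (k := fun x => α * (x ^ n * D.g₁ x) + β * D.g₂ x) (by fun_prop) fun t => by
        have := hαβ t
        rw [exp_s_natCast] at this ⊢
        linear_combination this
    rcases Nat.eq_zero_or_pos n with rfl | h
    · rwa [hz (by simp), mul_one] at hu
    · simpa [h.ne', hpos n h rfl] using congrFun hk 0
  · obtain ⟨hl, h20⟩ := hn hp
    obtain ⟨t₂, ht₂⟩ := exists_exp_mul_ne_zero h2 (by rw [h20]; exact one_ne_zero) (s (-p))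
    -- One turn multiplies the two terms by different factors, since `s(p) - s(-p) = p` is not an
    -- integer.
    have e1 := hαβ t₂
    have e2 := hαβ (t₂ + 2 * Real.pi * Complex.I * (1 : ℤ))
    rw [exp_add_two_pi, exp_mul_add_two_pi, exp_mul_add_two_pi] at e2
    rw [hl] at e1 e2
    have hne : Complex.exp (2 * Real.pi * Complex.I * (1 : ℤ) * s (-p)) -
        Complex.exp (2 * Real.pi * Complex.I * (1 : ℤ) * s p) ≠ 0 := fun h => by
      obtain ⟨n, hn⟩ := (exp_two_pi_s_eq_iff _ _).1 (sub_eq_zero.1 h)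
      exact hp (-n) (by push_cast; linear_combination -hn / 2)
    have e3 : (Complex.exp (2 * Real.pi * Complex.I * (1 : ℤ) * s (-p)) -
        Complex.exp (2 * Real.pi * Complex.I * (1 : ℤ) * s p)) *
        (β * (Complex.exp (s (-p) * t₂) * D.g₂ (Complex.exp t₂))) = 0 := by
      linear_combination e2 - Complex.exp (2 * Real.pi * Complex.I * (1 : ℤ) * s p) * e1
    exact (mul_eq_zero.1 ((mul_eq_zero.1 e3).resolve_left hne)).resolve_right ht₂

theorem OriginData.exists_isCanonical {m : ℕ} (a : Fin m → ℂ) {p : ℂ}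
    (hp : p ^ 2 = 1 + 4 * coeffA a m) (hneg : ∀ n : ℕ, 1 ≤ n → p ≠ -(n : ℂ)) :
    ∃ D : OriginData, D.IsCanonical a p := by
  obtain ⟨c, hc, hF⟩ := exists_isFrobeniusSeries a hp hneg
  rcases natCast_or_forall_int_ne hneg with ⟨n, rfl⟩ | hni
  · obtain ⟨lam, d, hd, hz, hpos, hsol⟩ := exists_log_solution a n hc hp hF
    have hpos' : ∀ k : ℕ, 1 ≤ k → (n : ℂ) = k → powerSum d 0 = 1 := fun k hk hnk => by
      rw [powerSum_zero_right]
      exact (hpos (by rw [Nat.cast_injective hnk]; exact hk)).1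
    have hz' : (n : ℂ) = 0 → lam = 1 := fun h => (hz (Nat.cast_eq_zero.1 h)).1
    have hni : ¬ ∀ k : ℤ, (n : ℂ) ≠ k := fun h => h n (by simp)
    exact ⟨⟨powerSum c, powerSum d, lam⟩, hF, hd.differentiable, hsol,
      OriginData.linearIndependent_of hc.differentiable.continuous hF.2.1
        hd.differentiable.continuous (fun h => absurd h hni) hpos' hz' hneg,
      fun h => absurd h hni, fun k hk hnk => ⟨hpos' k hk hnk, by
        obtain rfl := Nat.cast_injective hnk
        rw [hd.iteratedDeriv_zero, (hpos hk).2, mul_zero]⟩,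
      fun h => ⟨hz' h, by
        exact (powerSum_zero_right d).trans (hz (Nat.cast_eq_zero.1 h)).2⟩⟩
  · obtain ⟨d, hd, hG⟩ := exists_isFrobeniusSeries a (q := -p) (by rwa [neg_sq])
      fun n _ h => hni n (by simpa using h)
    have hpos : ∀ n : ℕ, 1 ≤ n → p ≠ n := fun n _ h => hni n (by simpa using h)
    have hz : p ≠ 0 := fun h => hni 0 (by simpa using h)
    refine ⟨⟨powerSum c, powerSum d, 0⟩, hF, hd.differentiable, ?_,
      OriginData.linearIndependent_of hc.differentiable.continuous hF.2.1
        hd.differentiable.continuous (fun _ => ⟨rfl, hG.2.1⟩)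
        (fun n hn h => absurd h (hpos n hn)) (fun h => absurd h hz) hneg,
      fun _ => ⟨rfl, hG⟩, fun n hn h => absurd h (hpos n hn), fun h => absurd h hz⟩
    convert hG.2.2 using 2 with t
    simp only [f₂, zero_mul, zero_add]

/-- For natural `p`, write the second solution of `D` as `α f₁ + β f₂` in the system of `E`.
Separating the logarithm gives `λ_D = β λ_E` and a relation between the entire parts, from which the
normalizations force `α = 0` and `β = 1`. For other `p` both entire parts are Frobenius series. -/
theorem OriginData.IsCanonical.unique {m : ℕ} {a : Fin m → ℂ} {p : ℂ} {D E : OriginData}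
    (hp : p ^ 2 = 1 + 4 * coeffA a m) (hneg : ∀ n : ℕ, 1 ≤ n → p ≠ -(n : ℂ))
    (hD : D.IsCanonical a p) (hE : E.IsCanonical a p) : D = E := by
  have hg : D.g₁ = E.g₁ := hD.first.unique hneg hE.first
  have hf : D.f₁ p = E.f₁ p := by
    funext t
    simp only [f₁, hg]
  suffices h : D.lam = E.lam ∧ D.g₂ = E.g₂ by
    cases D
    cases E
    simp_all
  rcases natCast_or_forall_int_ne hneg with ⟨n, rfl⟩ | hni
  · have hcE1 := hE.first.1.continuous
    have hcE2 := hE.entire.continuous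
    have hcD2 := hD.entire.continuous
    obtain ⟨α, β, h⟩ := hE.first.2.2.exists_eq_add hE.second hD.second hE.linearIndependent
    obtain ⟨hu, hk⟩ := eq_zero_of_log_relation (n := n) hcE1
      (by rw [hE.first.2.1]; exact one_ne_zero) (u := D.lam - β * E.lam)
      (k := fun x => D.g₂ x - α * (x ^ n * E.g₁ x) - β * E.g₂ x) (by fun_prop) fun t => by
        have := h t
        simp only [f₂, hf] at this
        simp only [f₁] at this
        rw [exp_s_natCast] at this ⊢
        linear_combination this
    have hk' : D.g₂ = fun x => α * (x ^ n * E.g₁ x) + β * E.g₂ x := by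
      funext x
      have : _ = (0 : ℂ) := congrFun hk x
      linear_combination this
    rcases Nat.eq_zero_or_pos n with rfl | hn
    · obtain ⟨hDl, hD0⟩ := hD.zero (by simp)
      obtain ⟨hEl, hE0⟩ := hE.zero (by simp)
      have h0 := congrFun hk' 0
      have hα : α = 0 := by simpa [hD0, hE0, hE.first.2.1] using h0.symm
      have hβ : β = 1 := by
        rw [hDl, hEl] at hu
        linear_combination -hu
      refine ⟨hDl.trans hEl.symm, ?_⟩
      rw [hk', hα, hβ]
      simp
    · obtain ⟨hD0, hDn⟩ := hD.posint n hn rfl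
      obtain ⟨hE0, hEn⟩ := hE.posint n hn rfl
      have hβ : β = 1 := by simpa [hD0, hE0, hn.ne'] using (congrFun hk' 0).symm
      obtain ⟨c, hc, hF⟩ := exists_isFrobeniusSeries a hp hneg
      have hgc : E.g₁ = powerSum c := hE.first.unique hneg hF
      have hc0 : c 0 = 1 := by rw [← powerSum_zero_right c]; exact hF.2.1
      have hsh : Differentiable ℂ fun x => α * (x ^ n * E.g₁ x) :=
        ((differentiable_id.pow n).mul hE.first.1).const_mul α
      have hder := congrArg (fun f => iteratedDeriv n f 0) hk'
      -- The coefficient of `x^n` isolates `α`: it vanishes in both functions `g₂`, and `g₁(0) = 1`.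
      have hα : α = 0 := by
        have h1 : (fun x => α * (x ^ n * E.g₁ x)) =
            powerSum (fun k => α * shift n c k) := by
          funext x
          rw [powerSum_const_mul, powerSum_shift, hgc]
        simp only [hβ, one_mul] at hder
        have h2 := iteratedDeriv_add (n := n) (x := (0 : ℂ)) (hsh.contDiff (n := n)).contDiffAt
          (hE.entire.contDiff (n := n)).contDiffAt
        rw [show (fun x => α * (x ^ n * E.g₁ x) + E.g₂ x) =
          (fun x => α * (x ^ n * E.g₁ x)) + E.g₂ from rfl, h2, hDn, hEn, h1,
          ((hc.shift n).const_mul α).iteratedDeriv_zero] at hder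
        simpa [shift, hc0, n.factorial_ne_zero] using hder
      refine ⟨by rw [hβ] at hu; linear_combination hu, ?_⟩
      rw [hk', hα, hβ]
      simp
  · obtain ⟨hDl, hDg⟩ := hD.nonint hni
    obtain ⟨hEl, hEg⟩ := hE.nonint hni
    exact ⟨hDl.trans hEl.symm, hDg.unique (fun n _ h => hni n (by simpa using h)) hEg⟩

theorem OriginData.IsCanonical.monodromy_mulVec {m : ℕ} {a : Fin m → ℂ} {p : ℂ}
    {D : OriginData} (hneg : ∀ n : ℕ, 1 ≤ n → p ≠ -(n : ℂ)) (hD : D.IsCanonical a p) (ε : ℤ)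
    (t : ℂ) :
    ![D.f₁ p (t + 2 * Real.pi * Complex.I * ε), D.f₂ p (t + 2 * Real.pi * Complex.I * ε)] =
      D.monodromy ε p *ᵥ ![D.f₁ p t, D.f₂ p t] := by
  -- Continuing `λ f₁ ln x` produces the factor of `s(p)`, whereas the matrix carries that of
  -- `s(-p)`; they agree whenever `λ ≠ 0`.
  have hl : D.lam * Complex.exp (2 * Real.pi * Complex.I * ε * s p) =
      D.lam * Complex.exp (2 * Real.pi * Complex.I * ε * s (-p)) := by
    rcases natCast_or_forall_int_ne hneg with ⟨n, rfl⟩ | hni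
    · rw [exp_two_pi_s_natCast]
    · rw [(hD.nonint hni).1, zero_mul, zero_mul]
  ext i
  fin_cases i
  · simp only [monodromy, f₁, exp_mul_add_two_pi, exp_add_two_pi]
    simp [Matrix.mulVec, dotProduct, Fin.sum_univ_two, mul_assoc]
  · simp only [monodromy, f₂, f₁, exp_mul_add_two_pi, exp_add_two_pi]
    simp [Matrix.mulVec, dotProduct, Fin.sum_univ_two]
    linear_combination (Complex.exp (s p * t) * D.g₁ (Complex.exp t) *
      (t + 2 * Real.pi * Complex.I * ε)) * hl

theorem OriginData.isUnit_monodromy (D : OriginData) (ε : ℤ) (p : ℂ) :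
    IsUnit (D.monodromy ε p) := by
  rw [Matrix.isUnit_iff_isUnit_det, monodromy, Matrix.det_fin_two_of, isUnit_iff_ne_zero]
  simp [Complex.exp_ne_zero]

open Filter Topology

/-! ### Asymptotics of the canonical solution along horizontal half-lines -/

theorem tendsto_ofReal_cexp_neg {k : ℝ} (hk : 0 < k) :
    Tendsto (fun x : ℝ => Complex.exp (-(k * x))) atTop (𝓝 0) := by
  rw [tendsto_zero_iff_norm_tendsto_zero]
  have h := Real.tendsto_exp_neg_atTop_nhds_zero.comp (tendsto_id.const_mul_atTop hk)
  refine h.congr fun x => ?_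
  rw [Complex.norm_exp]
  simp

theorem tendsto_mul_cexp_neg {k : ℝ} (hk : 0 < k) (r l : ℂ) :
    Tendsto (fun x : ℝ => r * (x + l) * Complex.exp (-(k * x))) atTop (𝓝 0) := by
  have h0 := tendsto_ofReal_cexp_neg hk
  have h1 : Tendsto (fun x : ℝ => (x : ℂ) * Complex.exp (-(k * x))) atTop (𝓝 0) := by
    rw [tendsto_zero_iff_norm_tendsto_zero]
    have h := ((Real.tendsto_pow_mul_exp_neg_atTop_nhds_zero 1).comp
      (tendsto_id.const_mul_atTop hk)).const_mul k⁻¹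
    rw [mul_zero] at h
    refine h.congr' ?_
    filter_upwards [eventually_ge_atTop 0] with x hx
    rw [norm_mul, Complex.norm_exp]
    simp [abs_of_nonneg hx]
    field_simp
  have := (h1.add (h0.const_mul l)).const_mul r
  simp only [mul_zero, add_zero] at this
  exact this.congr fun x => by ring

/-- The leading term of the exponent `S(x, a) - r(a) ln x`. -/
theorem tendsto_exponent {m : ℕ} (hm : 1 ≤ m) (a : Fin m → ℂ) (l : ℂ) :
    Tendsto (fun x : ℝ => (S a (x + l) - r a * (x + l)) * Complex.exp (-((m / 2 : ℝ) * x)))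
      atTop (𝓝 (2 / m * Complex.exp (m / 2 * l))) := by
  have hm0 : (0 : ℝ) < m / 2 := by positivity
  -- The term `k = 0` of `S` exists because `m ≥ 1`; it supplies the limit, and all others are of
  -- lower order.
  obtain ⟨N, hN⟩ : ∃ N, (m + 1) / 2 = N + 1 := ⟨(m + 1) / 2 - 1, by omega⟩
  have hS : Tendsto (fun x : ℝ => S a (x + l) * Complex.exp (-((m / 2 : ℝ) * x))) atTop
      (𝓝 (2 / m * Complex.exp (m / 2 * l))) := by
    simp only [S, hN, Finset.sum_range_succ', add_mul, Finset.sum_mul]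
    rw [← zero_add (2 / (m : ℂ) * _)]
    refine Tendsto.add ?_ (tendsto_const_nhds.congr fun x => ?_)
    · rw [← Finset.sum_const_zero (ι := ℕ) (M := ℂ) (s := Finset.range N)]
      refine tendsto_finsetSum _ fun k _ => ?_
      have := (tendsto_ofReal_cexp_neg (k := (k : ℝ) + 1) (by positivity)).const_mul
        (sqrtCoeff a (k + 1) / ((m : ℂ) / 2 - (k + 1 : ℕ)) *
          Complex.exp (((m : ℂ) / 2 - (k + 1 : ℕ)) * l))
      rw [mul_zero] at this
      refine this.congr fun x => ?_
      rw [mul_assoc, mul_assoc, ← Complex.exp_add, ← Complex.exp_add]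
      congr 2
      push_cast
      ring
    · rw [mul_assoc, ← Complex.exp_add]
      have : sqrtCoeff a 0 = 1 := by rw [sqrtCoeff]
      rw [this]
      congr 1
      · simp
      · congr 1
        push_cast
        ring
  have := hS.sub (tendsto_mul_cexp_neg hm0 (r a) l)
  rw [sub_zero] at this
  exact this.congr fun x => by ring

theorem tendsto_exponent_re {m : ℕ} (hm : 1 ≤ m) (a : Fin m → ℂ) (l : ℂ) :
    Tendsto (fun x : ℝ => (S a (x + l) - r a * (x + l)).re * Real.exp (-(m / 2 * x)))
      atTop (𝓝 (2 / m * Complex.exp (m / 2 * l)).re) := by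
  refine ((Complex.continuous_re.tendsto _).comp (tendsto_exponent hm a l)).congr fun x => ?_
  have : Complex.exp (-((m / 2 : ℝ) * x)) = (Real.exp (-(m / 2 * x)) : ℝ) := by
    push_cast
    rfl
  rw [Function.comp, this, Complex.re_mul_ofReal]

theorem exponent_re_eq {m : ℕ} (a : Fin m → ℂ) (l : ℂ) (x : ℝ) :
    (S a (x + l) - r a * (x + l)).re * Real.exp (-(m / 2 * x)) * Real.exp (m / 2 * x) =
      (S a (x + l) - r a * (x + l)).re := by
  rw [mul_assoc, ← Real.exp_add, neg_add_cancel, Real.exp_zero, mul_one]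

theorem tendsto_exp_half {m : ℕ} (hm : 1 ≤ m) :
    Tendsto (fun x : ℝ => Real.exp (m / 2 * x)) atTop atTop :=
  Real.tendsto_exp_atTop.comp (tendsto_id.const_mul_atTop (by positivity))

theorem IsCanonicalSolution.tendsto_mul_exp {m : ℕ} {Φ₀ : (Fin m → ℂ) → ℂ → ℂ}
    (h : IsCanonicalSolution m Φ₀) (a : Fin m → ℂ) {l : ℂ} (hl : |l.im| < 3 * Real.pi / m) :
    Tendsto (fun x : ℝ => Φ₀ a (x + l) * Complex.exp (S a (x + l) - r a * (x + l)))
      atTop (𝓝 1) := by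
  obtain ⟨-, c, hc, h⟩ := h
  -- Only the leading term of the expansion, at a single parameter, is needed.
  obtain ⟨B, R, h⟩ := h {a} isCompact_singleton _ hl 1
  have hg : 0 < gap m := by
    unfold gap
    split_ifs <;> norm_num
  rw [tendsto_iff_norm_sub_tendsto_zero]
  have hlim : Tendsto (fun x : ℝ => B * Real.exp (-(gap m * (x + l.re)))) atTop (𝓝 0) := by
    have := (Real.tendsto_exp_neg_atTop_nhds_zero.comp
      ((tendsto_atTop_add_const_right _ l.re tendsto_id).const_mul_atTop hg)).const_mul B
    rwa [mul_zero] at this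
  refine squeeze_zero' (Eventually.of_forall fun _ => norm_nonneg _) ?_ hlim
  filter_upwards [eventually_ge_atTop (R - l.re)] with x hx
  have := h a rfl (x + l) (by simp) (by simp; linarith)
  simp only [Finset.sum_range_one, hc, map_one, Nat.cast_zero, zero_mul, neg_zero,
    Complex.exp_zero, mul_one, Nat.cast_one, one_mul, Complex.add_re, Complex.ofReal_re] at this
  rwa [sub_eq_neg_add (S _ _), Complex.exp_add, ← mul_assoc]

theorem IsCanonicalSolution.norm_eq {m : ℕ} (Φ₀ : (Fin m → ℂ) → ℂ → ℂ) (a : Fin m → ℂ) (t : ℂ) :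
    ‖Φ₀ a t‖ = ‖Φ₀ a t * Complex.exp (S a t - r a * t)‖ * Real.exp (-(S a t - r a * t).re) := by
  rw [norm_mul, Complex.norm_exp, mul_assoc, ← Real.exp_add, add_neg_cancel, Real.exp_zero,
    mul_one]

/-- On the positive ray `Re (S - r ln x)` grows like `(2/m) x^(m/2)`, so the solution is
subdominant. -/
theorem IsCanonicalSolution.tendsto_zero {m : ℕ} (hm : 1 ≤ m) {Φ₀ : (Fin m → ℂ) → ℂ → ℂ}
    (h : IsCanonicalSolution m Φ₀) (a : Fin m → ℂ) :
    Tendsto (fun x : ℝ => Φ₀ a x) atTop (𝓝 0) := by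
  have hm' : (0 : ℝ) < m := by exact_mod_cast hm
  have h1 := (h.tendsto_mul_exp a (l := 0) (by simp; positivity)).norm
  have h2 := (tendsto_exponent_re hm a 0).pos_mul_atTop (by
    simp only [mul_zero, Complex.exp_zero, mul_one]
    rw [show (2 / m : ℂ) = ((2 / m : ℝ) : ℂ) by push_cast; rfl, Complex.ofReal_re]
    positivity) (tendsto_exp_half hm)
  simp only [exponent_re_eq] at h2
  have h3 := h1.mul (Real.tendsto_exp_neg_atTop_nhds_zero.comp h2)
  rw [mul_zero] at h3
  rw [tendsto_zero_iff_norm_tendsto_zero]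
  refine h3.congr fun x => ?_
  rw [Function.comp, ← IsCanonicalSolution.norm_eq, add_zero]

theorem IsCanonicalSolution.exists_ne_zero {m : ℕ} (hm : 1 ≤ m) {Φ₀ : (Fin m → ℂ) → ℂ → ℂ}
    (h : IsCanonicalSolution m Φ₀) (a : Fin m → ℂ) : ∃ t, Φ₀ a t ≠ 0 := by
  have hm' : (0 : ℝ) < m := by exact_mod_cast hm
  obtain ⟨x, hx⟩ := ((h.tendsto_mul_exp a (l := 0)
    (by simp; positivity)).eventually_ne one_ne_zero).exists
  exact ⟨_, left_ne_zero_of_mul hx⟩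

theorem mul_logOmega {m : ℕ} (hm : 1 ≤ m) (ε : ℤ) :
    (m : ℂ) * logOmega m ε = 2 * Real.pi * Complex.I * ε := by
  have : (m : ℂ) ≠ 0 := Nat.cast_ne_zero.2 (by omega)
  rw [logOmega, mul_div_cancel₀ _ this]

/-- The rotated ray has argument `±2π/m`, still inside the sector of validity, and `exp ((m/2) log
ω) = -1` reverses the sign of the leading exponent. -/
theorem IsCanonicalSolution.tendsto_norm_atTop {m : ℕ} (hm : 1 ≤ m) {ε : ℤ}
    (hε : ε = 1 ∨ ε = -1) {Φ₀ : (Fin m → ℂ) → ℂ → ℂ}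
    (h : IsCanonicalSolution m Φ₀) (a : Fin m → ℂ) :
    Tendsto (fun x : ℝ => ‖Φ₀ a (x + logOmega m ε)‖) atTop atTop := by
  have hm' : (0 : ℝ) < m := by exact_mod_cast hm
  have him : |(logOmega m ε).im| = 2 * Real.pi / m := by
    have : logOmega m ε = ((2 * Real.pi * ε / m : ℝ) : ℂ) * Complex.I := by
      rw [logOmega]
      push_cast
      ring
    rw [this, Complex.im_ofReal_mul, Complex.I_im, mul_one, abs_div, abs_mul, abs_mul]
    rcases hε with rfl | rfl <;> simp [abs_of_pos Real.pi_pos]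
  have hexp : Complex.exp (m / 2 * logOmega m ε) = -1 := by
    rw [div_mul_eq_mul_div, mul_logOmega hm]
    rcases hε with rfl | rfl
    · rw [← Complex.exp_pi_mul_I]
      congr 1
      push_cast
      ring
    · rw [← inv_neg_one, ← Complex.exp_pi_mul_I, ← Complex.exp_neg]
      congr 1
      push_cast
      ring
  have h1 := (h.tendsto_mul_exp a (l := logOmega m ε) (by
    rw [him]
    gcongr
    norm_num)).norm
  have h2 := (tendsto_exponent_re hm a (logOmega m ε)).neg_mul_atTop (by
    rw [hexp, show (2 / m * -1 : ℂ) = ((-(2 / m) : ℝ) : ℂ) by push_cast; ring, Complex.ofReal_re]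
    exact neg_neg_of_pos (by positivity)) (tendsto_exp_half hm)
  simp only [exponent_re_eq] at h2
  refine (h1.pos_mul_atTop (by simp) (Real.tendsto_exp_atTop.comp
    (tendsto_neg_atBot_atTop.comp h2))).congr fun x => ?_
  simp only [Function.comp]
  rw [← IsCanonicalSolution.norm_eq]

/-- A decaying and an unbounded function on the same ray. The parameters may differ because the
leading term of `S` does not involve them. -/
theorem IsCanonicalSolution.linearIndependent {m : ℕ} (hm : 1 ≤ m) {ε : ℤ}
    (hε : ε = 1 ∨ ε = -1) {Φ₀ : (Fin m → ℂ) → ℂ → ℂ}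
    (h : IsCanonicalSolution m Φ₀) (a b : Fin m → ℂ) :
    LinearIndependent ℂ ![Φ₀ a, fun t => Φ₀ b (t + logOmega m ε)] := by
  refine LinearIndependent.pair_iff.2 fun α β hαβ => ?_
  have hαβ : ∀ t, α * Φ₀ a t + β * Φ₀ b (t + logOmega m ε) = 0 := fun t => by
    simpa using congrFun hαβ t
  have hβ : β = 0 := by
    by_contra hβ
    have h1 := ((h.tendsto_zero hm a).const_mul (-α / β)).norm
    rw [mul_zero, norm_zero] at h1
    refine not_tendsto_nhds_of_tendsto_atTop (h.tendsto_norm_atTop hm hε b) 0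
      (h1.congr fun x => ?_)
    congr 1
    field_simp
    linear_combination -hαβ x
  obtain ⟨t, ht⟩ := h.exists_ne_zero hm a
  have := hαβ t
  rw [hβ, zero_mul, add_zero] at this
  exact ⟨(mul_eq_zero.1 this).resolve_right ht, hβ⟩

/-! ### The rotated solutions -/

theorem coeffA_scale {m : ℕ} (τ : ℂ) (a : Fin m → ℂ) (k : ℕ) :
    coeffA (scale τ a) k = τ ^ k * coeffA a k := by
  rcases k with _ | k
  · simp [coeffA]
  · by_cases h : k < m <;> simp [coeffA, scale, h]

/-- `P` is weighted homogeneous of degree `m`, and `τ^m = 1`. -/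
theorem P_scale {m : ℕ} {τ : ℂ} (hτ : τ ^ m = 1) (a : Fin m → ℂ) (x : ℂ) :
    P (scale τ a) (x * τ) = P a x := by
  refine Finset.sum_congr rfl fun k hk => ?_
  have : τ ^ k * τ ^ (m - k) = 1 := by
    rw [← pow_add, Nat.add_sub_cancel' (Finset.mem_range_succ_iff.1 hk), hτ]
  rw [coeffA_scale, mul_pow]
  linear_combination coeffA a k * x ^ (m - k) * this

theorem IsSolution.comp_add {m : ℕ} {a : Fin m → ℂ} {F : ℂ → ℂ} {l : ℂ}
    (hl : Complex.exp l ^ m = 1) (hF : IsSolution (scale (Complex.exp l) a) F) :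
    IsSolution a fun t => F (t + l) := by
  obtain ⟨dF, hF⟩ := isSolution_iff.1 hF
  refine IsSolution.of_hasDerivAt (F' := fun t => deriv F (t + l))
    (fun t => (dF (t + l)).hasDerivAt.comp_add_const t l) fun t => ?_
  refine ((dF.deriv (t + l)).hasDerivAt.comp_add_const t l).congr_deriv ?_
  rw [hF, Complex.exp_add, P_scale hl]

theorem exp_logOmega_zpow (m : ℕ) (ε k : ℤ) :
    Complex.exp (logOmega m ε) ^ k = Complex.exp (k * logOmega m ε) :=
  (Complex.exp_int_mul _ _).symm

theorem exp_logOmega_zpow_pow {m : ℕ} (hm : 1 ≤ m) (ε k : ℤ) :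
    Complex.exp (k * logOmega m ε) ^ m = 1 := by
  rw [← Complex.exp_nat_mul, mul_left_comm, mul_logOmega hm, Complex.exp_eq_one_iff]
  exact ⟨k * ε, by push_cast; ring⟩

theorem IsCanonicalSolution.isSolution_Phi {m : ℕ} (hm : 1 ≤ m) {Φ₀ : (Fin m → ℂ) → ℂ → ℂ}
    (h : IsCanonicalSolution m Φ₀) (ε k : ℤ) (a : Fin m → ℂ) : IsSolution a (Phi ε Φ₀ k a) := by
  refine IsSolution.comp_add (exp_logOmega_zpow_pow hm ε k) ?_
  rw [← exp_logOmega_zpow]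
  exact h.1 _

theorem IsCanonicalSolution.linearIndependent_Phi {m : ℕ} (hm : 1 ≤ m) {ε : ℤ}
    (hε : ε = 1 ∨ ε = -1) {Φ₀ : (Fin m → ℂ) → ℂ → ℂ}
    (h : IsCanonicalSolution m Φ₀) (k : ℤ) (a : Fin m → ℂ) :
    LinearIndependent ℂ ![Phi ε Φ₀ k a, Phi ε Φ₀ (k + 1) a] := by
  refine LinearIndependent.pair_iff.2 fun α β hαβ => ?_
  refine LinearIndependent.pair_iff.1 (h.linearIndependent hm hε
    (scale (Complex.exp (logOmega m ε) ^ k) a) (scale (Complex.exp (logOmega m ε) ^ (k + 1)) a))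
    α β ?_
  funext t
  have := congrFun hαβ (t - k * logOmega m ε)
  simp only [Phi, Pi.add_apply, Pi.smul_apply, Pi.zero_apply, sub_add_cancel] at this ⊢
  rw [← this]
  congr 3
  push_cast
  ring

/-- The parameter returns to itself because `ω^m = 1`, but the point of the covering does not: it
moves by a full turn. -/
theorem Phi_add_natCast {m : ℕ} (hm : 1 ≤ m) (ε : ℤ) (Φ₀ : (Fin m → ℂ) → ℂ → ℂ) (k : ℤ)
    (a : Fin m → ℂ) (t : ℂ) :
    Phi ε Φ₀ (k + m) a t = Phi ε Φ₀ k a (t + m * logOmega m ε) := by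
  have h1 : Complex.exp (logOmega m ε) ^ (k + m : ℤ) = Complex.exp (logOmega m ε) ^ k := by
    have := exp_logOmega_zpow_pow hm ε 1
    rw [Int.cast_one, one_mul] at this
    rw [zpow_add₀ (Complex.exp_ne_zero _), zpow_natCast, this, mul_one]
  simp only [Phi, h1]
  congr 1
  push_cast
  ring

/-! ### Connection matrices and the telescoping product. -/

theorem vecCons_eq_mulVec (M : Matrix (Fin 2) (Fin 2) ℂ) (u v w z : ℂ) :
    ![u, v] = M *ᵥ ![w, z] ↔ u = M 0 0 * w + M 0 1 * z ∧ v = M 1 0 * w + M 1 1 * z := by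
  simp [funext_iff, Fin.forall_fin_two]

theorem matrix_eq_of_mulVec_eq {F G : ℂ → ℂ} (h : LinearIndependent ℂ ![F, G])
    {M N : Matrix (Fin 2) (Fin 2) ℂ} (hMN : ∀ t, M *ᵥ ![F t, G t] = N *ᵥ ![F t, G t]) : M = N := by
  have key : ∀ i, M i 0 = N i 0 ∧ M i 1 = N i 1 := fun i =>
    eq_and_eq_of_linearIndependent h fun t => by
      simpa [Matrix.mulVec, dotProduct, Fin.sum_univ_two] using congrFun (hMN t) i
  ext i j
  fin_cases j
  · exact (key i).1
  · exact (key i).2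

theorem exists_connection_matrix {m : ℕ} {a : Fin m → ℂ} {F G U V : ℂ → ℂ}
    (hF : IsSolution a F) (hG : IsSolution a G) (hU : IsSolution a U) (hV : IsSolution a V)
    (hFG : LinearIndependent ℂ ![F, G]) :
    ∃ M : Matrix (Fin 2) (Fin 2) ℂ, ∀ t, ![U t, V t] = M *ᵥ ![F t, G t] := by
  obtain ⟨α, β, h1⟩ := hF.exists_eq_add hG hU hFG
  obtain ⟨γ, δ, h2⟩ := hF.exists_eq_add hG hV hFG
  exact ⟨!![α, β; γ, δ], fun t => (vecCons_eq_mulVec _ _ _ _ _).2 ⟨h1 t, h2 t⟩⟩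

theorem stokesSibuyaMatrix_prod_mulVec {m : ℕ} {a : Fin m → ℂ} {ε : ℤ}
    {Φ₀ : (Fin m → ℂ) → ℂ → ℂ} {c : ℤ → ℂ × ℂ} (hc : ∀ k, IsStokesSibuyaCoeff ε Φ₀ k a (c k))
    (n : ℕ) (t : ℂ) :
    ![Phi ε Φ₀ (0 - 1) a t, Phi ε Φ₀ 0 a t] =
      (List.ofFn fun k : Fin n => stokesSibuyaMatrix (c (k.val : ℤ))).prod *ᵥ
        ![Phi ε Φ₀ (n - 1) a t, Phi ε Φ₀ n a t] := by
  induction n with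
  | zero => simp
  | succ n ih =>
    have hstep : ![Phi ε Φ₀ (n - 1) a t, Phi ε Φ₀ n a t] =
        stokesSibuyaMatrix (c n) *ᵥ ![Phi ε Φ₀ n a t, Phi ε Φ₀ (n + 1) a t] :=
      (vecCons_eq_mulVec _ _ _ _ _).2 ⟨by simpa [stokesSibuyaMatrix] using hc n t,
        by simp [stokesSibuyaMatrix]⟩
    rw [ih, hstep, List.ofFn_succ', List.concat_eq_append, List.prod_append, List.prod_singleton,
      Matrix.mulVec_mulVec]
    simp

end

end StokesSibuya

theorem theorem6p2 (m : ℕ) (hm : 1 ≤ m) (ε : ℤ) (hε : ε = 1 ∨ ε = -1)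
    (Φ₀ : (Fin m → ℂ) → ℂ → ℂ) (hΦ₀ : IsCanonicalSolution m Φ₀)
    (a : Fin m → ℂ) (p : ℂ) (hp : p ^ 2 = 1 + 4 * coeffA a m)
    (hpneg : ∀ n : ℕ, 1 ≤ n → p ≠ -(n : ℂ)) :
    -- the Stokes–Sibuya coefficients `(C_k, C̃_k)` are well defined
    (∀ k : ℤ, ∃! c : ℂ × ℂ, IsStokesSibuyaCoeff ε Φ₀ k a c) ∧
    -- the canonical system of solutions at the origin is well defined
    (∃! D : OriginData, D.IsCanonical a p) ∧
    ∀ D : OriginData, D.IsCanonical a p →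
      -- the explicit matrix is invertible, and is the monodromy matrix `x ↦ ω ^ m x` at the origin
      IsUnit (D.monodromy ε p) ∧
      (∀ t, ![D.f₁ p (t + m * logOmega m ε), D.f₂ p (t + m * logOmega m ε)] =
        D.monodromy ε p *ᵥ ![D.f₁ p t, D.f₂ p t]) ∧
      -- the `0∞` connection matrix is well defined
      (∃! M₀ : Matrix (Fin 2) (Fin 2) ℂ, IsConnectionMatrix ε Φ₀ 0 a p D M₀) ∧
      ∀ M₀ : Matrix (Fin 2) (Fin 2) ℂ, IsConnectionMatrix ε Φ₀ 0 a p D M₀ →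
        IsUnit M₀ ∧
        ∀ c : ℤ → ℂ × ℂ, (∀ k, IsStokesSibuyaCoeff ε Φ₀ k a (c k)) →
          (List.ofFn fun k : Fin m => stokesSibuyaMatrix (c (k.val : ℤ))).prod =
            M₀ * (D.monodromy ε p)⁻¹ * M₀⁻¹ := by
  have hsol := fun k => hΦ₀.isSolution_Phi hm ε k a
  have hli := fun k => hΦ₀.linearIndependent_Phi hm hε k a
  refine ⟨fun k => ?_, ?_, fun D hD => ?_⟩
  · obtain ⟨α, β, h⟩ := (hsol k).exists_eq_add (hsol (k + 1)) (hsol (k - 1)) (hli k)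
    refine ⟨(α, β), h, fun c hc => ?_⟩
    obtain ⟨h1, h2⟩ := eq_and_eq_of_linearIndependent (hli k) fun t => (hc t).symm.trans (h t)
    exact Prod.ext h1 h2
  · obtain ⟨D, hD⟩ := OriginData.exists_isCanonical a hp hpneg
    exact ⟨D, hD, fun E hE => hE.unique hp hpneg hD⟩
  · have hunit := D.isUnit_monodromy ε p
    have hmon : ∀ t, ![D.f₁ p (t + m * logOmega m ε), D.f₂ p (t + m * logOmega m ε)] =
        D.monodromy ε p *ᵥ ![D.f₁ p t, D.f₂ p t] := fun t => by
      rw [mul_logOmega hm]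
      exact hD.monodromy_mulVec hpneg ε t
    have hf₁ : IsSolution a (D.f₁ p) := hD.first.2.2
    have hli0 : LinearIndependent ℂ ![Phi ε Φ₀ (0 - 1) a, Phi ε Φ₀ 0 a] := hli (0 - 1)
    refine ⟨hunit, hmon, ?_, fun M hM => ?_⟩
    · obtain ⟨M, hM⟩ := exists_connection_matrix hf₁ hD.second (hsol (0 - 1)) (hsol 0)
        hD.linearIndependent
      exact ⟨M, hM, fun N hN => matrix_eq_of_mulVec_eq hD.linearIndependent fun t =>
        (hN t).symm.trans (hM t)⟩
    · obtain ⟨N, hN⟩ := exists_connection_matrix (hsol (0 - 1)) (hsol 0) hf₁ hD.second hli0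
      have hMN : M * N = 1 := matrix_eq_of_mulVec_eq hli0 fun t => by
        rw [← Matrix.mulVec_mulVec, ← hN t, ← hM t, Matrix.one_mulVec]
      have hMu : IsUnit M := IsUnit.of_mul_eq_one N hMN
      refine ⟨hMu, fun c hc => ?_⟩
      set Q := (List.ofFn fun k : Fin m => stokesSibuyaMatrix (c (k.val : ℤ))).prod with hQ
      -- Applied to `(f₁, f₂)(x)`, the left side is `Q (Φ_{-1}, Φ_0)(ω^m x) = Q (Φ_{m-1}, Φ_m)(x) =
      -- (Φ_{-1}, Φ_0)(x)`.
      have hprod : Q * M * D.monodromy ε p = M :=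
        matrix_eq_of_mulVec_eq hD.linearIndependent fun t => by
          rw [← Matrix.mulVec_mulVec, ← hmon, ← Matrix.mulVec_mulVec, ← hM, ← hM,
            stokesSibuyaMatrix_prod_mulVec hc m t, ← Phi_add_natCast hm, ← Phi_add_natCast hm,
            zero_add, show (0 - 1 + m : ℤ) = m - 1 by ring]
      have h1 := (Matrix.isUnit_iff_isUnit_det _).1 hunit
      have h2 := (Matrix.isUnit_iff_isUnit_det _).1 hMu
      calc Q = Q * M * D.monodromy ε p * (D.monodromy ε p)⁻¹ * M⁻¹ := by
            rw [Matrix.mul_nonsing_inv_cancel_right _ _ h1,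
              Matrix.mul_nonsing_inv_cancel_right _ _ h2]
        _ = M * (D.monodromy ε p)⁻¹ * M⁻¹ := by rw [hprod]
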